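/- Let $p$ be an odd prime and let $m\ge 5$ be an integer such that either $m$ is odd, or $m$ is even and $m\ge p+3$. Then there exists a chiral polyhedron $\mathcal P$ (an abstract polytope of rank $3$ whose automorphism group has exactly two orbits on flags, with adjacent flags always in different orbits) with $|\mathrm{Aut}(\mathcal P)|=2p^m$ which is non-tight; here a chiral polyhedron of Schläfli type $\{k_1,k_2\}$ is called tight if $|\mathrm{Aut}(\mathcal P)|=k_1k_2$. Moreover $\mathcal P$ can be taken of Schläfli type $\{p^2,2p^e\}$ (faces of size $p^2$, vertices of valency $2p^e$), where $e\ge 1$ is determined by $m$: there is an even integer $r$ with $1\le r\le p-1$ such that $m=(p-1)(e-1)+r+1$ if $m$ is odd, and $m=(p-1)(e-1)+r+2$ if $m$ is even. -/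

import Mathlib

universe u

/-- Two flags (maximal chains) of a poset with a rank function are `j`-adjacent if they differ in
just one face, of rank `j`. -/
def FlagJAdjacent {P : Type u} [PartialOrder P] (rank : P → ℤ) (j : ℤ) (Φ Ψ : Flag P) : Prop :=
  Φ ≠ Ψ ∧ ∀ F : P, rank F ≠ j → (F ∈ Φ ↔ F ∈ Ψ)

/-- Two flags are adjacent if they are `j`-adjacent for some `j`. -/
def FlagAdjacent {P : Type u} [PartialOrder P] (rank : P → ℤ) (Φ Ψ : Flag P) : Prop :=
  ∃ j : ℤ, FlagJAdjacent rank j Φ Ψ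

/-- An abstract polytope of rank `n`: a poset with a strictly monotone rank function with range
`{-1, 0, …, n}` which satisfies the conditions (P1) to (P4). -/
structure AbstractPolytope (n : ℕ) where
  /-- The faces of the polytope. -/
  Face : Type u
  /-- The incidence order. -/
  [order : PartialOrder Face]
  /-- The rank function. -/
  rank : Face → ℤ
  rank_strictMono : StrictMono rank
  rank_range : Set.range rank = Set.Icc (-1) (n : ℤ)
  /-- (P1) There is a least face. -/
  exists_least : ∃ F : Face, IsBot F
  /-- (P1) There is a greatest face. -/
  exists_greatest : ∃ F : Face, IsTop F
  /-- (P2) Each flag has exactly `n + 2` faces. -/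
  flag_encard : ∀ Φ : Flag Face, (Φ : Set Face).encard = n + 2
  /-- (P3) Strong flag-connectedness: any two flags `Φ`, `Ψ` are joined by a sequence of
  successively adjacent flags, each of which contains `Φ ∩ Ψ`. -/
  strongly_flag_connected : ∀ Φ Ψ : Flag Face,
    Relation.ReflTransGen
      (fun Λ Λ' : Flag Face => FlagAdjacent rank Λ Λ' ∧
        (Φ : Set Face) ∩ Ψ ⊆ Λ ∧ (Φ : Set Face) ∩ Ψ ⊆ Λ') Φ Ψ
  /-- (P4) The diamond condition. -/
  diamond : ∀ i : ℤ, 0 ≤ i → i ≤ n - 1 → ∀ F G : Face,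
    rank F = i - 1 → rank G = i + 1 → F ≤ G →
      {H : Face | rank H = i ∧ F < H ∧ H < G}.encard = 2

namespace AbstractPolytope

attribute [instance] AbstractPolytope.order

variable {n : ℕ}

/-- The automorphism group of a polytope: the group of order automorphisms of its face poset. -/
abbrev Aut (P : AbstractPolytope.{u} n) : Type u := P.Face ≃o P.Face

/-- A polytope is chiral if its automorphism group has (exactly) two orbits on its set of flags,
with every two adjacent flags lying in different orbits. -/
def IsChiral (P : AbstractPolytope.{u} n) : Prop :=
  Nat.card (MulAction.orbitRel.Quotient P.Aut (Flag P.Face)) = 2 ∧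
    ∀ Φ Ψ : Flag P.Face, FlagAdjacent P.rank Φ Ψ → Ψ ∉ MulAction.orbit P.Aut Φ

/-- `P` has Schläfli type `{k₁, …, kₙ₋₁}` (with `kᵢ` written `k (i - 1)`): for `1 ≤ i ≤ n - 1`,
every `2`-section between an `(i - 2)`-face and an incident `(i + 1)`-face has `kᵢ` edges, which
are the faces of rank `i` of `P` in this section. -/
def HasSchlafliType (P : AbstractPolytope.{u} n) (k : Fin (n - 1) → ℕ) : Prop :=
  ∀ (j : Fin (n - 1)) (F G : P.Face),
    P.rank F = (j : ℤ) - 1 → P.rank G = (j : ℤ) + 2 → F ≤ G →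
      {H : P.Face | P.rank H = (j : ℤ) + 1 ∧ F < H ∧ H < G}.encard = k j

/-- Tightness of a chiral polyhedron: for its Schläfli type `{k₁, k₂}`, the automorphism group has
order `k₁ k₂`. (A chiral polyhedron has twice as many flags as automorphisms, so this says that it
has `2 k₁ k₂` flags.) -/
def IsTight (P : AbstractPolytope.{u} 3) : Prop :=
  ∃ k₁ k₂ : ℕ, P.HasSchlafliType ![k₁, k₂] ∧ Nat.card P.Aut = k₁ * k₂

end AbstractPolytope

/-! Let a finite group G be generated by rotations s₁ and s₂ about a face and a vertex, both
nontrivial, with (s₁s₂)² = 1 and ⟨s₁⟩ ∩ ⟨s₂⟩ = 1. The cosets of ⟨s₂⟩, ⟨s₁s₂⟩ and ⟨s₁⟩ then form a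
polyhedron whose flags fall into two regular G-orbits, and every adjacency interchanges the orbits.
An automorphism outside G would induce an endomorphism of G inverting s₂ and fixing s₁s₂. If there
is none, the polyhedron is chiral with automorphism group G (`RotationPair.isChiral`,
`RotationPair.card_aut`).

To obtain such a G, let R be a finite commutative ring, additively generated by the powers of a unit
t with t^p = 1, with an involution bar inverting t. The dihedral group of order 2p² acts on R
through t and bar, and r^p acts trivially. In the semidirect product r^p is identified with an
element w of R of additive order p such that tw = w and bar w = -w. An endomorphism as above must
negate all of R and fix r, so it both negates and fixes w = r^p. Then 2w = 0, which is impossible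
for odd p (`TwistedRing.not_exists_hom`). The sign of w under bar also yields the intersection
condition (`TwistedRing.mk_eq_one_of_pow`).

For R take O/λ^k with O = ℤ[ζ], λ = ζ - 1, k even and w = λ^(k-1). Since conj λ = -ζ⁻¹λ and k - 1 is
odd, conjugation negates w modulo λ^k. This gives |G| = 2p^(k+1), which covers odd m. For even m,
the fibre product of O/λ^k with ℤ/p² over the residue field contributes one more factor p. As p is
associated to λ^(p-1), the additive order of 1 is p^e with e = ⌈k/(p-1)⌉. This produces both the
valency 2p^e and the relation between m, e and r. -/

open Subgroup

/-! ### Rotation pairs and their half-turn -/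

/-- A pair of generating rotations of a finite group, subject to the conditions which make the
coset geometry of the stabilisers `⟨s₂⟩`, `⟨s₁ * s₂⟩`, `⟨s₁⟩` a polyhedron. -/
structure RotationPair (G : Type) [Group G] where
  /-- The rotation about the base face. -/
  s₁ : G
  /-- The rotation about the base vertex. -/
  s₂ : G
  half_turn : (s₁ * s₂) * (s₁ * s₂) = 1
  inter : ∀ x ∈ zpowers s₁, x ∈ zpowers s₂ → x = 1
  s₁_ne : s₁ ≠ 1
  s₂_ne : s₂ ≠ 1
  generate : closure {s₂, s₁ * s₂} = ⊤

namespace RotationPair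

variable {G : Type} [Group G] (S : RotationPair G)

/-- The half-turn about the base edge. -/
def τ : G := S.s₁ * S.s₂

lemma τ_mul_self : S.τ * S.τ = 1 := S.half_turn

lemma τ_inv : S.τ⁻¹ = S.τ := inv_eq_of_mul_eq_one_left S.τ_mul_self

lemma τ_eq : S.τ = S.s₁ * S.s₂ := rfl

lemma τ_eq' : S.τ = S.s₂⁻¹ * S.s₁⁻¹ := by rw [← S.τ_inv, τ_eq, mul_inv_rev]

lemma τ_notMem₁ : S.τ ∉ zpowers S.s₁ := fun h =>
  S.s₂_ne (S.inter _ (((zpowers S.s₁).mul_mem_cancel_left (mem_zpowers _)).1 h) (mem_zpowers _))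

lemma τ_notMem₂ : S.τ ∉ zpowers S.s₂ := fun h =>
  S.s₁_ne (S.inter _ (mem_zpowers _) (((zpowers S.s₂).mul_mem_cancel_right (mem_zpowers _)).1 h))

lemma τ_ne_one : S.τ ≠ 1 := fun h => S.τ_notMem₁ (h ▸ one_mem _)

lemma mem_zpowers_τ {x : G} : x ∈ zpowers S.τ ↔ x = 1 ∨ x = S.τ := by
  constructor
  · rintro ⟨n, rfl⟩
    have h2 : S.τ ^ (2 : ℤ) = 1 := by rw [zpow_ofNat, pow_two, S.τ_mul_self]
    rcases Int.even_or_odd' n with ⟨k, rfl | rfl⟩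
    · left; simp [zpow_mul, h2]
    · right; simp [zpow_add, zpow_mul, h2]
  · rintro (rfl | rfl)
    exacts [one_mem _, mem_zpowers _]

lemma τ_mem : S.τ ∈ zpowers S.τ := mem_zpowers _

lemma s₁_mem : S.s₁ ∈ zpowers S.s₁ := mem_zpowers _

lemma s₂_mem : S.s₂ ∈ zpowers S.s₂ := mem_zpowers _

lemma s₂_mul_τ : S.s₂ * S.τ = S.s₁⁻¹ := by rw [τ_eq', mul_inv_cancel_left]

lemma eq_one_of_mem₁₂ {x : G} (h1 : x ∈ zpowers S.s₂) (h2 : x ∈ zpowers S.τ) : x = 1 := by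
  rcases S.mem_zpowers_τ.1 h2 with h | rfl
  exacts [h, (S.τ_notMem₂ h1).elim]

lemma eq_one_of_mem₂₃ {x : G} (h1 : x ∈ zpowers S.τ) (h2 : x ∈ zpowers S.s₁) : x = 1 := by
  rcases S.mem_zpowers_τ.1 h1 with h | rfl
  exacts [h, (S.τ_notMem₁ h2).elim]

/-- As τ = s₂⁻¹s₁⁻¹, the element u s₂⁻¹ lies in both cyclic groups. This and the next two lemmas
decide which flags share a vertex and a face. -/
lemma mul_τ_mem₁ {u : G} (hu : u ∈ zpowers S.s₂) (h : u * S.τ ∈ zpowers S.s₁) : u = S.s₂ := by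
  have h1 : u * S.s₂⁻¹ ∈ zpowers S.s₁ := by
    rw [τ_eq', ← mul_assoc] at h
    exact ((zpowers S.s₁).mul_mem_cancel_right (inv_mem S.s₁_mem)).1 h
  exact mul_inv_eq_one.1 (S.inter _ h1 (mul_mem hu (inv_mem S.s₂_mem)))

lemma τ_mul_mem₁ {u : G} (hu : u ∈ zpowers S.s₂) (h : S.τ * u ∈ zpowers S.s₁) :
    u = S.s₂⁻¹ := by
  have h1 : S.s₂ * u ∈ zpowers S.s₁ := by
    rw [τ_eq, mul_assoc] at h
    exact ((zpowers S.s₁).mul_mem_cancel_left S.s₁_mem).1 h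
  exact eq_inv_of_mul_eq_one_right (S.inter _ h1 (mul_mem S.s₂_mem hu))

lemma τ_mul_mul_τ_mem₁ {u : G} (hu : u ∈ zpowers S.s₂) (h : S.τ * u * S.τ ∈ zpowers S.s₁) :
    u = 1 := by
  have h1 : S.s₂ * u * S.s₂⁻¹ ∈ zpowers S.s₁ := by
    nth_rw 2 [τ_eq'] at h
    rw [τ_eq] at h
    refine ((zpowers S.s₁).mul_mem_cancel_left S.s₁_mem).1
      (((zpowers S.s₁).mul_mem_cancel_right (inv_mem S.s₁_mem)).1 ?_)
    simpa [mul_assoc] using h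
  have h2 := S.inter _ h1 (mul_mem (mul_mem S.s₂_mem hu) (inv_mem S.s₂_mem))
  simpa [mul_inv_eq_one] using h2

/-! ### The poset of cosets -/

/-- The stabilisers of the base faces of ranks `-1, 0, 1, 2, 3`. -/
def stab : Fin 5 → Subgroup G := ![⊤, zpowers S.s₂, zpowers S.τ, zpowers S.s₁, ⊤]

@[simp] lemma stab_zero : S.stab 0 = ⊤ := rfl
@[simp] lemma stab_one : S.stab 1 = zpowers S.s₂ := rfl
@[simp] lemma stab_two : S.stab 2 = zpowers S.τ := rfl
@[simp] lemma stab_three : S.stab 3 = zpowers S.s₁ := rfl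
@[simp] lemma stab_four : S.stab 4 = ⊤ := rfl

/-- The faces are the cosets of the stabilisers of the base faces. -/
def Face : Type := Σ i : Fin 5, G ⧸ S.stab i

/-- The face of index `i` (rank `i - 1`) which contains `g`. -/
def coset (i : Fin 5) (g : G) : S.Face := ⟨i, g⟩

variable {S}

/-- The index of a face, which is one more than its rank. -/
def Face.idx (a : S.Face) : Fin 5 := a.1

@[simp] lemma idx_coset (i : Fin 5) (g : G) : (S.coset i g).idx = i := rfl

lemma exists_coset (a : S.Face) : ∃ g, a = S.coset a.idx g := by
  obtain ⟨i, q⟩ := a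
  obtain ⟨g, rfl⟩ := QuotientGroup.mk_surjective q
  exact ⟨g, rfl⟩

lemma coset_eq_coset_iff {i : Fin 5} {g h : G} : S.coset i g = S.coset i h ↔ g⁻¹ * h ∈ S.stab i := by
  constructor
  · intro h1
    exact QuotientGroup.eq.1 (eq_of_heq (Sigma.mk.inj h1).2)
  · intro h1
    exact congrArg (Sigma.mk i) (QuotientGroup.eq.2 h1)

lemma idx_eq_of_coset_eq {i j : Fin 5} {g h : G} (h1 : S.coset i g = S.coset j h) : i = j :=
  congrArg Face.idx h1

lemma coset_mul_of_mem {i : Fin 5} {g u : G} (hu : u ∈ S.stab i) : S.coset i (g * u) = S.coset i g := by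
  rw [eq_comm, coset_eq_coset_iff]; simpa

lemma exists_of_coset_eq {i : Fin 5} {g h : G} (h1 : S.coset i g = S.coset i h) :
    ∃ u ∈ S.stab i, h = g * u := ⟨g⁻¹ * h, coset_eq_coset_iff.1 h1, by simp⟩

instance : LE S.Face where
  le a b := a.idx ≤ b.idx ∧ ∃ g, a = S.coset a.idx g ∧ b = S.coset b.idx g

lemma coset_le_coset {i j : Fin 5} (h : i ≤ j) (g : G) : S.coset i g ≤ S.coset j g := ⟨h, g, rfl, rfl⟩

lemma le_antisymm_of_idx {a b : S.Face} (h : a ≤ b) (hi : a.idx = b.idx) : a = b := by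
  obtain ⟨-, g, h1, h2⟩ := h
  rw [h1, h2, hi]

/-- This is what makes incidence (sharing an element) transitive. Among proper faces only the
indices 1, 2, 3 occur, and there τ = s₂⁻¹s₁⁻¹ is the required factorisation. -/
lemma mem_mul_stab {i j k : Fin 5} (hij : i < j) (hjk : j < k) {x : G} (hx : x ∈ S.stab j) :
    ∃ u ∈ S.stab i, ∃ v ∈ S.stab k, x = u * v := by
  by_cases hi : i = 0
  · subst hi
    exact ⟨x, by simp, 1, one_mem _, by simp⟩
  by_cases hk : k = 4
  · subst hk
    exact ⟨1, one_mem _, x, by simp, by simp⟩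
  obtain ⟨rfl, rfl, rfl⟩ : i = 1 ∧ j = 2 ∧ k = 3 := by
    clear hx; revert i j k; decide
  rcases S.mem_zpowers_τ.1 hx with rfl | rfl
  · exact ⟨1, one_mem _, 1, one_mem _, by simp⟩
  · exact ⟨_, inv_mem S.s₂_mem, _, inv_mem S.s₁_mem, S.τ_eq'⟩

instance : PartialOrder S.Face where
  le_refl a := ⟨le_rfl, (exists_coset a).imp fun g h => ⟨h, h⟩⟩
  le_antisymm a b h h' := le_antisymm_of_idx h (le_antisymm h.1 h'.1)
  le_trans a b c h h' := by
    rcases h.1.eq_or_lt with e | hab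
    · rwa [le_antisymm_of_idx h e]
    rcases h'.1.eq_or_lt with e | hbc
    · rwa [← le_antisymm_of_idx h' e]
    obtain ⟨g, ha, hb⟩ := h.2
    obtain ⟨g', hb', hc⟩ := h'.2
    obtain ⟨x, hx, rfl⟩ := exists_of_coset_eq (hb.symm.trans hb')
    obtain ⟨u, hu, v, hv, rfl⟩ := mem_mul_stab hab hbc hx
    refine ⟨(hab.trans hbc).le, g * u, by rwa [coset_mul_of_mem hu], ?_⟩
    rwa [← coset_mul_of_mem (g := g * u) hv, mul_assoc]

lemma lt_iff {a b : S.Face} : a < b ↔ a ≤ b ∧ a.idx < b.idx := by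
  constructor
  · intro h
    refine ⟨h.le, lt_of_le_of_ne h.le.1 fun e => h.ne (le_antisymm_of_idx h.le e)⟩
  · rintro ⟨h, hi⟩
    exact lt_of_le_of_ne h (by rintro rfl; exact lt_irrefl _ hi)

lemma coset_zero_eq (g h : G) : S.coset 0 g = S.coset 0 h := coset_eq_coset_iff.2 (by simp)

lemma coset_four_eq (g h : G) : S.coset 4 g = S.coset 4 h := coset_eq_coset_iff.2 (by simp)

lemma coset_two_mul_τ (g : G) : S.coset 2 (g * S.τ) = S.coset 2 g := coset_mul_of_mem S.τ_mem

lemma coset_two_eq_iff {g h : G} : S.coset 2 g = S.coset 2 h ↔ h = g ∨ h = g * S.τ := by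
  rw [coset_eq_coset_iff, stab_two, mem_zpowers_τ, inv_mul_eq_one, inv_mul_eq_iff_eq_mul, eq_comm]

lemma coset_zero_le (g : G) (a : S.Face) : S.coset 0 g ≤ a := by
  obtain ⟨h, ha⟩ := exists_coset a
  rw [ha, coset_zero_eq g h]
  exact coset_le_coset (Fin.zero_le _) _

lemma le_coset_four (g : G) (a : S.Face) : a ≤ S.coset 4 g := by
  obtain ⟨h, ha⟩ := exists_coset a
  rw [ha, coset_four_eq g h]
  exact coset_le_coset (Fin.le_last _) _

/-! ### Flags, parametrised by `G × Bool` -/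

variable (S) in
/-- The element of `G` whose coset of index `i` belongs to the flag `(g, ε)`. -/
def rep (g : G) (ε : Bool) (i : Fin 5) : G := if ε = true ∧ i = 3 then g * S.τ else g

@[simp] lemma rep_false (g : G) (i : Fin 5) : S.rep g false i = g := by simp [rep]
@[simp] lemma rep_true_three (g : G) : S.rep g true 3 = g * S.τ := by simp [rep]
lemma rep_of_ne {i : Fin 5} (hi : i ≠ 3) (g : G) (ε : Bool) : S.rep g ε i = g := by
  simp [rep, hi]

lemma coset_rep_le {i j : Fin 5} (h : i ≤ j) (g : G) (ε : Bool) :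
    S.coset i (S.rep g ε i) ≤ S.coset j (S.rep g ε j) := by
  cases ε
  · simpa using coset_le_coset h g
  by_cases hj : j = 3
  · subst hj
    rcases h.eq_or_lt with rfl | h
    · exact le_rfl
    rw [rep_of_ne h.ne, rep_true_three]
    have h2 : i ≤ 2 := by revert i; decide
    exact (coset_le_coset h2 g).trans ((coset_two_mul_τ g).ge.trans (coset_le_coset (by decide) _))
  by_cases hi : i = 3
  · subst hi
    have : j = 4 := by revert j; decide
    subst this
    exact le_coset_four _ _
  rw [rep_of_ne hi, rep_of_ne hj]
  exact coset_le_coset h g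

variable (S) in
/-- The flag of the faces with representatives `rep g ε`. -/
def flag (g : G) (ε : Bool) : Flag S.Face where
  carrier := Set.range fun i => S.coset i (S.rep g ε i)
  Chain' := by
    rintro _ ⟨i, rfl⟩ _ ⟨j, rfl⟩ -
    exact (le_total i j).imp (fun h => coset_rep_le h g ε) (fun h => coset_rep_le h g ε)
  max_chain' := by
    intro s hs hsub
    refine hsub.antisymm fun a ha => ⟨a.idx, ?_⟩
    have h1 := hsub ⟨a.idx, rfl⟩
    rcases hs.total h1 ha with h | h
    · exact le_antisymm_of_idx h rfl
    · exact (le_antisymm_of_idx h rfl).symm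

lemma mem_flag {a : S.Face} {g : G} {ε : Bool} :
    a ∈ S.flag g ε ↔ a = S.coset a.idx (S.rep g ε a.idx) := by
  constructor
  · rintro ⟨i, rfl⟩; rfl
  · intro h; exact ⟨a.idx, h.symm⟩

lemma coset_mem_flag_iff {i : Fin 5} {x g : G} {ε : Bool} :
    S.coset i x ∈ S.flag g ε ↔ S.coset i x = S.coset i (S.rep g ε i) := mem_flag

lemma coset_rep_mem_flag (i : Fin 5) (g : G) (ε : Bool) : S.coset i (S.rep g ε i) ∈ S.flag g ε :=
  ⟨i, rfl⟩

/-- Faces of a flag are determined by their indices. -/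
lemma eq_of_mem_of_idx {Φ : Flag S.Face} {a b : S.Face} (ha : a ∈ Φ) (hb : b ∈ Φ)
    (h : a.idx = b.idx) : a = b := by
  rcases Φ.le_or_le ha hb with h1 | h1
  · exact le_antisymm_of_idx h1 h
  · exact (le_antisymm_of_idx h1 h.symm).symm

lemma flag_eq_of_forall_mem {Φ : Flag S.Face} {g : G} {ε : Bool}
    (h : ∀ i, S.coset i (S.rep g ε i) ∈ Φ) : Φ = S.flag g ε := by
  refine SetLike.coe_injective ((S.flag g ε).max_chain' Φ.chain_le ?_).symm
  rintro _ ⟨i, rfl⟩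
  exact h i

/-- In a flag without an edge all faces would share some g: a vertex and a face in it are incident,
and improper faces contain everything. The edge through g is then comparable to all of them, so
maximality puts it into the flag. -/
lemma exists_edge_mem (Φ : Flag S.Face) : ∃ g, S.coset 2 g ∈ Φ := by
  by_contra! hno
  obtain ⟨g, hg⟩ : ∃ g, ∀ a ∈ Φ, a = S.coset a.idx g := by
    have key : ∀ g : G, (∀ a ∈ Φ, a.idx = 1 → a = S.coset 1 g) → (∀ a ∈ Φ, a.idx = 3 → a = S.coset 3 g) →
        ∀ a ∈ Φ, a = S.coset a.idx g := by
      intro g h1 h3 a ha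
      obtain ⟨h, hh⟩ := exists_coset a
      generalize hi : a.idx = i at hh
      fin_cases i
      · rw [hh]; exact coset_zero_eq _ _
      · exact h1 a ha hi
      · exact (hno h (hh ▸ ha)).elim
      · exact h3 a ha hi
      · rw [hh]; exact coset_four_eq _ _
    by_cases hv : ∃ v ∈ Φ, v.idx = 1
    · obtain ⟨v, hv, hvi⟩ := hv
      by_cases hf : ∃ f ∈ Φ, f.idx = 3
      · obtain ⟨f, hf, hfi⟩ := hf
        have hle : v ≤ f := by
          rcases Φ.le_or_le hv hf with h | h
          · exact h
          · exact absurd h.1 (by rw [hvi, hfi]; decide)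
        obtain ⟨-, g, e1, e2⟩ := hle
        rw [hvi] at e1
        rw [hfi] at e2
        exact ⟨g, key g (fun a ha hi => (eq_of_mem_of_idx ha hv (hi.trans hvi.symm)).trans e1)
          (fun a ha hi => (eq_of_mem_of_idx ha hf (hi.trans hfi.symm)).trans e2)⟩
      · obtain ⟨g, e1⟩ := exists_coset v
        rw [hvi] at e1
        exact ⟨g, key g (fun a ha hi => (eq_of_mem_of_idx ha hv (hi.trans hvi.symm)).trans e1)
          (fun a ha hi => (hf ⟨a, ha, hi⟩).elim)⟩
    · by_cases hf : ∃ f ∈ Φ, f.idx = 3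
      · obtain ⟨f, hf, hfi⟩ := hf
        obtain ⟨g, e1⟩ := exists_coset f
        rw [hfi] at e1
        exact ⟨g, key g (fun a ha hi => (hv ⟨a, ha, hi⟩).elim)
          (fun a ha hi => (eq_of_mem_of_idx ha hf (hi.trans hfi.symm)).trans e1)⟩
      · exact ⟨1, key 1 (fun a ha hi => (hv ⟨a, ha, hi⟩).elim)
          (fun a ha hi => (hf ⟨a, ha, hi⟩).elim)⟩
  refine hno g (Flag.mem_iff_forall_le_or_ge.2 fun b hb => ?_)
  rw [hg b hb]
  exact (le_total 2 b.idx).imp (fun h => coset_le_coset h g) (fun h => coset_le_coset h g)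

lemma exists_vertex_mem {Φ : Flag S.Face} {g : G} (hg : S.coset 2 g ∈ Φ) :
    S.coset 1 g ∈ Φ ∨ S.coset 1 (g * S.τ) ∈ Φ := by
  by_cases hv : ∃ v ∈ Φ, v.idx = 1
  · obtain ⟨v, hv, hvi⟩ := hv
    have hle : v ≤ S.coset 2 g := by
      rcases Φ.le_or_le hv hg with h | h
      · exact h
      · exact absurd h.1 (by rw [hvi, idx_coset]; decide)
    obtain ⟨-, h, e1, e2⟩ := hle
    rw [hvi] at e1
    rw [e1] at hv
    rcases coset_two_eq_iff.1 e2 with rfl | rfl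
    · exact Or.inl hv
    · exact Or.inr hv
  · left
    refine Flag.mem_iff_forall_le_or_ge.2 fun b hb => ?_
    rcases Φ.le_or_le hg hb with h | h
    · exact Or.inl ((coset_le_coset (by decide) g).trans h)
    · obtain ⟨x, hx⟩ := exists_coset b
      have h1 := h.1
      rw [idx_coset] at h1
      generalize hi : b.idx = i at h1 hx
      have : i = 0 ∨ i = 1 ∨ i = 2 := by clear hx hi; revert i; decide
      rcases this with rfl | rfl | rfl
      · right; rw [hx]; exact coset_zero_le _ _
      · exact (hv ⟨b, hb, hi⟩).elim
      · left; rw [← eq_of_mem_of_idx hg hb hi.symm]; exact coset_le_coset (by decide) g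

lemma exists_face_mem {Φ : Flag S.Face} {g : G} (hg : S.coset 2 g ∈ Φ) :
    S.coset 3 g ∈ Φ ∨ S.coset 3 (g * S.τ) ∈ Φ := by
  by_cases hv : ∃ v ∈ Φ, v.idx = 3
  · obtain ⟨v, hv, hvi⟩ := hv
    have hle : S.coset 2 g ≤ v := by
      rcases Φ.le_or_le hv hg with h | h
      · exact absurd h.1 (by rw [hvi, idx_coset]; decide)
      · exact h
    obtain ⟨-, h, e2, e1⟩ := hle
    rw [hvi] at e1
    rw [e1] at hv
    rcases coset_two_eq_iff.1 e2 with rfl | rfl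
    · exact Or.inl hv
    · exact Or.inr hv
  · left
    refine Flag.mem_iff_forall_le_or_ge.2 fun b hb => ?_
    rcases Φ.le_or_le hg hb with h | h
    · obtain ⟨x, hx⟩ := exists_coset b
      have h1 := h.1
      rw [idx_coset] at h1
      generalize hi : b.idx = i at h1 hx
      have : i = 4 ∨ i = 3 ∨ i = 2 := by clear hx hi; revert i; decide
      rcases this with rfl | rfl | rfl
      · left; rw [hx]; exact le_coset_four _ _
      · exact (hv ⟨b, hb, hi⟩).elim
      · right; rw [← eq_of_mem_of_idx hg hb hi.symm]; exact coset_le_coset (by decide) g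
    · exact Or.inr (h.trans (coset_le_coset (by decide) g))

lemma coset_zero_mem (Φ : Flag S.Face) (g : G) : S.coset 0 g ∈ Φ :=
  Flag.mem_iff_forall_le_or_ge.2 fun b _ => Or.inl (coset_zero_le g b)

lemma coset_four_mem (Φ : Flag S.Face) (g : G) : S.coset 4 g ∈ Φ :=
  Flag.mem_iff_forall_le_or_ge.2 fun b _ => Or.inr (le_coset_four g b)

/-- Every flag is one of the flags `flag g ε`. -/
lemma exists_flag_eq (Φ : Flag S.Face) : ∃ g ε, Φ = S.flag g ε := by
  obtain ⟨g, hg, hv⟩ : ∃ g, S.coset 2 g ∈ Φ ∧ S.coset 1 g ∈ Φ := by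
    obtain ⟨g, hg⟩ := exists_edge_mem Φ
    rcases exists_vertex_mem hg with h | h
    · exact ⟨g, hg, h⟩
    · exact ⟨g * S.τ, by rwa [coset_two_mul_τ], h⟩
  obtain ⟨ε, hf⟩ : ∃ ε, S.coset 3 (S.rep g ε 3) ∈ Φ := by
    rcases exists_face_mem hg with h | h
    · exact ⟨false, by simpa using h⟩
    · exact ⟨true, by simpa using h⟩
  refine ⟨g, ε, flag_eq_of_forall_mem fun i => ?_⟩
  fin_cases i
  · exact coset_zero_mem _ _
  · exact (rep_of_ne (i := 1) (by decide) g ε).symm ▸ hv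
  · exact (rep_of_ne (i := 2) (by decide) g ε).symm ▸ hg
  · exact hf
  · exact coset_four_mem _ _

/-- Vertex and edge determine g because ⟨s₂⟩ and ⟨τ⟩ meet trivially. The face then determines the
Boolean because τ ∉ ⟨s₁⟩. -/
lemma flag_injective {g h : G} {ε δ : Bool} (H : S.flag g ε = S.flag h δ) : g = h ∧ ε = δ := by
  have key : ∀ i, S.coset i (S.rep g ε i) = S.coset i (S.rep h δ i) := fun i =>
    coset_mem_flag_iff.1 (H ▸ coset_rep_mem_flag i g ε)
  have h1 := key 1
  have h2 := key 2
  have h3 := key 3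
  rw [rep_of_ne (by decide), rep_of_ne (by decide)] at h1 h2
  have hgh : g = h := inv_mul_eq_one.1 (S.eq_one_of_mem₁₂ (coset_eq_coset_iff.1 h1) (coset_eq_coset_iff.1 h2))
  subst hgh
  refine ⟨rfl, ?_⟩
  rw [coset_eq_coset_iff] at h3
  cases ε <;> cases δ <;> simp only [rep_false, rep_true_three] at h3
  · rfl
  · exact (S.τ_notMem₁ (by simpa using h3)).elim
  · exact (S.τ_notMem₁ (by simpa [S.τ_inv] using h3)).elim
  · rfl

/-! ### Adjacency of flags -/

/-- The rank of a face. -/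
def rank (a : S.Face) : ℤ := (a.idx : ℕ) - 1

lemma rank_coset (i : Fin 5) (g : G) : rank (S.coset i g) = (i : ℕ) - 1 := rfl

lemma rank_eq_iff {a : S.Face} {i : Fin 5} : rank a = (i : ℕ) - 1 ↔ a.idx = i := by
  rw [rank, sub_left_inj, Nat.cast_inj, Fin.val_inj]

lemma rank_strictMono : StrictMono (rank : S.Face → ℤ) := by
  intro a b h
  have := (lt_iff.1 h).2
  simp only [rank]
  omega

lemma mem_flag_iff_of_coset_eq {g h : G} {ε δ : Bool} {a : S.Face}
    (H : S.coset a.idx (S.rep g ε a.idx) = S.coset a.idx (S.rep h δ a.idx)) :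
    a ∈ S.flag g ε ↔ a ∈ S.flag h δ := by
  rw [mem_flag, mem_flag, H]

lemma jAdjacent_of_forall {g h : G} {ε δ : Bool} (i : Fin 5) (hne : S.flag g ε ≠ S.flag h δ)
    (H : ∀ k ≠ i, S.coset k (S.rep g ε k) = S.coset k (S.rep h δ k)) {j : ℤ}
    (hj : j = (i : ℕ) - 1) : FlagJAdjacent rank j (S.flag g ε) (S.flag h δ) := by
  refine ⟨hne, fun F hF => mem_flag_iff_of_coset_eq (H _ fun e => hF ?_)⟩
  rw [hj, rank_eq_iff, e]

lemma FlagJAdjacent.coset_eq {g h : G} {ε δ : Bool} {j : ℤ}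
    (H : FlagJAdjacent rank j (S.flag g ε) (S.flag h δ)) (i : Fin 5) (hi : j ≠ (i : ℕ) - 1) :
    S.coset i (S.rep g ε i) = S.coset i (S.rep h δ i) :=
  coset_mem_flag_iff.1 ((H.2 _ (by rw [rank_coset]; exact hi.symm)).1 (coset_rep_mem_flag i g ε))

/-- The first component of the flag adjacent to `flag g ε` which differs from it in rank `i`. -/
def nbr (S : RotationPair G) (g : G) (ε : Bool) : Fin 3 → G :=
  ![g * S.τ, if ε then g * S.s₂⁻¹ else g * S.s₂, g]

lemma eq_or_of_vertex_of_edge {g h : G} {ε δ : Bool}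
    (h1 : S.coset 1 (S.rep g ε 1) = S.coset 1 (S.rep h δ 1))
    (h2 : S.coset 2 (S.rep g ε 2) = S.coset 2 (S.rep h δ 2)) : h = g := by
  rw [rep_of_ne (by decide), rep_of_ne (by decide), coset_eq_coset_iff] at h1 h2
  exact (inv_mul_eq_one.1 (S.eq_one_of_mem₁₂ h1 h2)).symm

lemma eq_or_of_edge_of_face {g h : G} {ε δ : Bool}
    (h2 : S.coset 2 (S.rep g ε 2) = S.coset 2 (S.rep h δ 2))
    (h3 : S.coset 3 (S.rep g ε 3) = S.coset 3 (S.rep h δ 3)) :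
    (h = g ∧ δ = ε) ∨ (h = g * S.τ ∧ δ = !ε) := by
  rw [rep_of_ne (by decide), rep_of_ne (by decide), coset_two_eq_iff] at h2
  rw [coset_eq_coset_iff, stab_three] at h3
  have n1 := S.τ_notMem₁
  rcases h2 with rfl | rfl <;> cases ε <;> cases δ <;>
    simp [mul_assoc, S.τ_inv, S.τ_mul_self] at h3 ⊢ <;> exact (n1 h3).elim

lemma eq_or_of_vertex_of_face {g h : G} {ε δ : Bool}
    (h1 : S.coset 1 (S.rep g ε 1) = S.coset 1 (S.rep h δ 1))
    (h3 : S.coset 3 (S.rep g ε 3) = S.coset 3 (S.rep h δ 3)) :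
    (h = g ∧ δ = ε) ∨ (h = (if ε then g * S.s₂⁻¹ else g * S.s₂) ∧ δ = !ε) := by
  rw [rep_of_ne (by decide), rep_of_ne (by decide)] at h1
  obtain ⟨u, hu, rfl⟩ := exists_of_coset_eq h1
  rw [stab_one] at hu
  rw [coset_eq_coset_iff, stab_three] at h3
  cases ε <;> cases δ <;> simp [mul_assoc, S.τ_inv] at h3 ⊢
  · exact S.inter _ h3 hu
  · exact S.mul_τ_mem₁ hu h3
  · exact S.τ_mul_mem₁ hu h3
  · exact S.τ_mul_mul_τ_mem₁ hu (by rwa [mul_assoc])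

lemma jAdjacent_nbr (g : G) (ε : Bool) (i : Fin 3) :
    FlagJAdjacent rank (i : ℕ) (S.flag g ε) (S.flag (S.nbr g ε i) !ε) := by
  have hne : S.flag g ε ≠ S.flag (S.nbr g ε i) !ε := fun e => by
    have := (flag_injective e).2
    cases ε <;> simp at this
  refine jAdjacent_of_forall i.castSucc.succ hne (fun k hk => ?_) (by simp)
  have hτ : g * S.τ * S.τ = g := by rw [mul_assoc, τ_mul_self, mul_one]
  fin_cases k
  · exact coset_zero_eq _ _
  · change S.coset 1 (S.rep _ _ 1) = S.coset 1 (S.rep _ _ 1)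
    rw [rep_of_ne (by decide), rep_of_ne (by decide), eq_comm]
    fin_cases i
    · exact (hk rfl).elim
    · cases ε
      · exact coset_mul_of_mem S.s₂_mem
      · exact coset_mul_of_mem (inv_mem S.s₂_mem)
    · rfl
  · change S.coset 2 (S.rep _ _ 2) = S.coset 2 (S.rep _ _ 2)
    rw [rep_of_ne (by decide), rep_of_ne (by decide), eq_comm]
    fin_cases i
    · exact coset_two_mul_τ _
    · exact (hk rfl).elim
    · rfl
  · change S.coset 3 (S.rep _ _ 3) = S.coset 3 (S.rep _ _ 3)
    fin_cases i
    · cases ε <;> simp [nbr, hτ]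
    · cases ε
      · simp only [nbr, rep_false, Bool.not_false, rep_true_three]
        rw [eq_comm]
        simp only [Fin.mk_one, Matrix.cons_val_one, Matrix.cons_val_zero, Bool.false_eq_true,
          if_false, mul_assoc, s₂_mul_τ]
        exact coset_mul_of_mem (inv_mem S.s₁_mem)
      · simp only [nbr, rep_false, Bool.not_true, rep_true_three]
        simp only [Fin.mk_one, Matrix.cons_val_one, Matrix.cons_val_zero, if_true]
        have : g * S.τ = g * S.s₂⁻¹ * S.s₁⁻¹ := by rw [τ_eq', mul_assoc]
        rw [this]
        exact coset_mul_of_mem (inv_mem S.s₁_mem)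
    · exact (hk rfl).elim
  · exact coset_four_eq _ _

/-- Every adjacency flips the Boolean, so the flag graph is bipartite. This is the source of the two
flag orbits. -/
lemma jAdjacent_iff {g h : G} {ε δ : Bool} {j : ℤ} :
    FlagJAdjacent rank j (S.flag g ε) (S.flag h δ) ↔
      δ = (!ε) ∧ ∃ i : Fin 3, j = (i : ℕ) ∧ h = S.nbr g ε i := by
  constructor
  · intro H
    have hne : ¬ (h = g ∧ δ = ε) := by
      rintro ⟨rfl, rfl⟩
      exact H.1 rfl
    by_cases j1 : j = 0
    · subst j1
      rcases eq_or_of_edge_of_face (FlagJAdjacent.coset_eq H 2 (by decide))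
        (FlagJAdjacent.coset_eq H 3 (by decide)) with h' | ⟨h1, h2⟩
      · exact (hne h').elim
      · exact ⟨h2, 0, rfl, h1⟩
    by_cases j2 : j = 1
    · subst j2
      rcases eq_or_of_vertex_of_face (FlagJAdjacent.coset_eq H 1 (by decide))
        (FlagJAdjacent.coset_eq H 3 (by decide)) with h' | ⟨h1, h2⟩
      · exact (hne h').elim
      · exact ⟨h2, 1, rfl, h1⟩
    have h1 := eq_or_of_vertex_of_edge (FlagJAdjacent.coset_eq H 1 (by simpa using j1))
        (FlagJAdjacent.coset_eq H 2 (by simpa using j2))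
    by_cases j3 : j = 2
    · subst j3
      refine ⟨?_, 2, rfl, h1⟩
      rcases Bool.eq_or_eq_not δ ε with h' | h'
      · exact (hne ⟨h1, h'⟩).elim
      · exact h'
    -- For j outside {0, 1, 2} the flags agree in all proper ranks, so they would be equal.
    · have := eq_or_of_edge_of_face (FlagJAdjacent.coset_eq H 2 (by simpa using j2))
        (FlagJAdjacent.coset_eq H 3 (by simpa using j3))
      rcases this with h' | h'
      · exact (hne h').elim
      · exact (S.τ_ne_one (by simpa [h1] using h'.1)).elim
  · rintro ⟨rfl, i, rfl, rfl⟩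
    exact jAdjacent_nbr g ε i

/-! ### Strong flag-connectedness -/

lemma _root_.FlagAdjacent.symm {P : Type*} [PartialOrder P] {rank : P → ℤ} {Φ Ψ : Flag P}
    (h : FlagAdjacent rank Φ Ψ) : FlagAdjacent rank Ψ Φ :=
  h.imp fun _ h => ⟨h.1.symm, fun F hF => (h.2 F hF).symm⟩

/-- Connectedness by a path of adjacent flags which contain the set `A`. -/
def Conn (A : Set S.Face) : Flag S.Face → Flag S.Face → Prop :=
  Relation.ReflTransGen fun Λ Λ' => FlagAdjacent rank Λ Λ' ∧ A ⊆ Λ ∧ A ⊆ Λ'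

lemma Conn.symm {A : Set S.Face} {Φ Ψ : Flag S.Face} (h : Conn A Φ Ψ) : Conn A Ψ Φ :=
  have : Std.Symm fun Λ Λ' : Flag S.Face => FlagAdjacent rank Λ Λ' ∧ A ⊆ Λ ∧ A ⊆ Λ' :=
    ⟨fun _ _ h => ⟨h.1.symm, h.2.2, h.2.1⟩⟩
  Relation.ReflTransGen.stdSymm.symm _ _ h

lemma Conn.trans {A : Set S.Face} {Φ Ψ Ω : Flag S.Face} (h : Conn A Φ Ψ) (h' : Conn A Ψ Ω) :
    Conn A Φ Ω :=
  Relation.ReflTransGen.trans h h'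

lemma conn_nbr {A : Set S.Face} {g : G} {ε : Bool} (i : Fin 3) (h1 : A ⊆ S.flag g ε)
    (h2 : A ⊆ S.flag (S.nbr g ε i) !ε) : Conn A (S.flag g ε) (S.flag (S.nbr g ε i) !ε) :=
  Relation.ReflTransGen.single ⟨⟨_, jAdjacent_nbr g ε i⟩, h1, h2⟩

/-- If right multiplication by `s` can be realised by paths within a family of flags, so can right
multiplication by the elements of `⟨s⟩`. -/
lemma conn_of_mem_zpowers {A : Set S.Face} {s : G} {p : G → Prop} (hp : ∀ g, p g ↔ p (g * s))
    {ε : Bool} (H : ∀ g, p g → Conn A (S.flag g ε) (S.flag (g * s) ε)) {g u : G} (hg : p g)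
    (hu : u ∈ zpowers s) : Conn A (S.flag g ε) (S.flag (g * u) ε) := by
  obtain ⟨n, rfl⟩ := hu
  suffices p (g * s ^ n) ∧ Conn A (S.flag g ε) (S.flag (g * s ^ n) ε) from this.2
  induction n using Int.induction_on with
  | zero => simpa using ⟨hg, Relation.ReflTransGen.refl⟩
  | succ n ih =>
    have e : g * s ^ ((n : ℤ) + 1) = g * s ^ (n : ℤ) * s := by rw [zpow_add_one, mul_assoc]
    rw [e]
    exact ⟨(hp _).1 ih.1, ih.2.trans (H _ ih.1)⟩
  | pred n ih =>
    have e : g * s ^ (-(n : ℤ)) = g * s ^ (-(n : ℤ) - 1) * s := by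
      rw [zpow_sub_one, mul_assoc, mul_assoc, inv_mul_cancel, mul_one]
    rw [e] at ih
    have h1 := (hp _).2 ih.1
    exact ⟨h1, ih.2.trans (H _ h1).symm⟩

lemma nbr_zero (g : G) (ε : Bool) : S.nbr g ε 0 = g * S.τ := rfl
lemma nbr_one_false (g : G) : S.nbr g false 1 = g * S.s₂ := rfl

/-- Adjacencies of ranks 2 and 1 in succession multiply g by s₂ and keep the vertex. -/
lemma conn_of_vertex {A : Set S.Face} {g h : G} {ε δ : Bool}
    (hA : ∀ k ζ, S.coset 1 k = S.coset 1 g → A ⊆ S.flag k ζ)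
    (h1 : S.coset 1 g = S.coset 1 h) : Conn A (S.flag g ε) (S.flag h δ) := by
  have flip : ∀ k, S.coset 1 k = S.coset 1 g → Conn A (S.flag k false) (S.flag k true) :=
    fun k hk => conn_nbr 2 (hA _ _ hk) (hA _ _ hk)
  have hs : ∀ k, S.coset 1 (k * S.s₂) = S.coset 1 k := fun k => coset_mul_of_mem S.s₂_mem
  obtain ⟨u, hu, rfl⟩ := exists_of_coset_eq h1
  have main : Conn A (S.flag g true) (S.flag (g * u) true) := by
    refine conn_of_mem_zpowers (p := fun k => S.coset 1 k = S.coset 1 g) (fun k => by rw [hs])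
      (fun k hk => (flip k hk).symm.trans ?_) rfl hu
    exact conn_nbr 1 (hA _ _ hk) (hA _ _ (by rwa [nbr_one_false, hs]))
  have f1 := flip g rfl
  have f2 := flip _ h1.symm
  cases ε <;> cases δ
  exacts [f1.trans (main.trans f2.symm), f1.trans main, main.trans f2.symm, main]

lemma conn_of_edge {A : Set S.Face} {g h : G} {ε δ : Bool}
    (hA : ∀ k ζ, S.coset 2 k = S.coset 2 g → A ⊆ S.flag k ζ)
    (h1 : S.coset 2 g = S.coset 2 h) : Conn A (S.flag g ε) (S.flag h δ) := by
  have hτ := coset_two_mul_τ (S := S) g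
  have f1 : Conn A (S.flag g false) (S.flag g true) := conn_nbr 2 (hA _ _ rfl) (hA _ _ rfl)
  have f2 : ∀ ε, Conn A (S.flag g ε) (S.flag (g * S.τ) !ε) := fun ε =>
    conn_nbr 0 (hA _ _ rfl) (hA _ _ hτ)
  rcases coset_two_eq_iff.1 h1 with rfl | rfl
  · cases ε <;> cases δ
    exacts [Relation.ReflTransGen.refl, f1, f1.symm, Relation.ReflTransGen.refl]
  · cases ε <;> cases δ
    exacts [f1.trans (f2 true), f2 false, f2 true, f1.symm.trans (f2 false)]

/-- Adjacencies of ranks 1 and 0 in succession multiply g by s₂τ = s₁⁻¹ and keep the face. -/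
lemma conn_of_face {A : Set S.Face} {g h : G} {ε δ : Bool}
    (hA : ∀ k ζ, S.coset 3 (S.rep k ζ 3) = S.coset 3 (S.rep g ε 3) → A ⊆ S.flag k ζ)
    (h1 : S.coset 3 (S.rep g ε 3) = S.coset 3 (S.rep h δ 3)) :
    Conn A (S.flag g ε) (S.flag h δ) := by
  have hτ : ∀ k, k * S.τ * S.τ = k := fun k => by rw [mul_assoc, τ_mul_self, mul_one]
  have flip : ∀ k ζ, S.coset 3 (S.rep k ζ 3) = S.coset 3 (S.rep g ε 3) →
      Conn A (S.flag k ζ) (S.flag (S.rep k ζ 3) false) := by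
    intro k ζ hk
    cases ζ
    · exact Relation.ReflTransGen.refl
    · rw [rep_true_three] at hk ⊢
      exact conn_nbr 0 (hA _ _ (by simpa using hk)) (hA _ _ (by simpa [nbr_zero] using hk))
  refine (flip g ε rfl).trans (Conn.trans ?_ (flip h δ h1.symm).symm)
  obtain ⟨u, hu, e⟩ := exists_of_coset_eq h1
  rw [stab_three, ← zpowers_inv] at hu
  rw [e]
  have hs : ∀ k, S.coset 3 (k * S.s₁⁻¹) = S.coset 3 k := fun k =>
    coset_mul_of_mem (inv_mem S.s₁_mem)
  refine conn_of_mem_zpowers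
    (p := fun k => S.coset 3 k = S.coset 3 (S.rep g ε 3)) (fun k => by rw [hs]) ?_ rfl hu
  intro k hk
  have e1 : k * S.s₁⁻¹ = k * S.s₂ * S.τ := by rw [← s₂_mul_τ, mul_assoc]
  have m1 : A ⊆ S.flag (k * S.s₂) true := hA _ _ (by rw [rep_true_three, ← e1, hs, hk])
  have m2 : A ⊆ S.flag (k * S.s₁⁻¹) false := hA _ _ (by rw [rep_false, hs, hk])
  have c1 := conn_nbr (g := k) (ε := false) 1 (hA _ _ (by simpa using hk)) m1
  rw [e1] at m2 ⊢
  exact c1.trans (conn_nbr (ε := true) 0 m1 m2)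

lemma conn_univ {A : Set S.Face} (hA : ∀ k ζ, A ⊆ S.flag k ζ) (g h : G) (ε δ : Bool) :
    Conn A (S.flag g ε) (S.flag h δ) := by
  have flip : ∀ k ε δ, Conn A (S.flag k ε) (S.flag k δ) := fun k ε δ =>
    conn_of_vertex (fun _ _ _ => hA _ _) rfl
  have h1 : ∀ k, Conn A (S.flag k true) (S.flag (k * S.s₂) true) := fun k =>
    (flip k _ _).trans (conn_nbr (ε := false) 1 (hA _ _) (hA _ _))
  have h2 : ∀ k, Conn A (S.flag k true) (S.flag (k * S.τ) true) := fun k =>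
    (flip k _ _).trans (conn_nbr (ε := false) 0 (hA _ _) (hA _ _))
  suffices ∀ u, Conn A (S.flag g true) (S.flag (g * u) true) by
    have := this (g⁻¹ * h)
    rw [mul_inv_cancel_left] at this
    exact (flip g _ _).trans (this.trans (flip h _ _))
  intro u
  have hu : u ∈ closure {S.s₂, S.s₁ * S.s₂} := S.generate ▸ mem_top u
  induction hu using closure_induction_right with
  | one => rw [mul_one]; exact Relation.ReflTransGen.refl
  | mul_right x hx y hy ih =>
    rw [← mul_assoc]
    rcases hy with rfl | rfl
    exacts [ih.trans (h1 _), ih.trans (h2 _)]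
  | mul_inv_cancel x hx y hy ih =>
    refine ih.trans (Conn.symm ?_)
    have e : g * x = g * (x * y⁻¹) * y := by simp [mul_assoc]
    rw [e]
    rcases hy with rfl | rfl
    exacts [h1 _, h2 _]

/-- Flags with common proper faces of two ranks are equal or adjacent. Otherwise the common proper
faces have at most one rank, and a path runs around that face, or through all of G by means of the
generators. -/
lemma strongly_connected (Φ Ψ : Flag S.Face) : Conn ((Φ : Set S.Face) ∩ Ψ) Φ Ψ := by
  obtain ⟨g, ε, rfl⟩ := exists_flag_eq Φ
  obtain ⟨h, δ, rfl⟩ := exists_flag_eq Ψ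
  by_cases hadj : FlagAdjacent rank (S.flag g ε) (S.flag h δ)
  · exact Relation.ReflTransGen.single ⟨hadj, Set.inter_subset_left, Set.inter_subset_right⟩
  by_cases heq : h = g ∧ δ = ε
  · obtain ⟨rfl, rfl⟩ := heq
    exact Relation.ReflTransGen.refl
  have adj : ∀ i : Fin 3, ¬ (h = S.nbr g ε i ∧ δ = !ε) := by
    rintro i ⟨rfl, rfl⟩
    exact hadj ⟨_, jAdjacent_nbr g ε i⟩
  -- The common faces of proper rank all have the same rank.
  have key : ∀ i : Fin 5, (∀ a ∈ (S.flag g ε : Set S.Face) ∩ S.flag h δ,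
      a.idx = 0 ∨ a.idx = i ∨ a.idx = 4) → ∀ k ζ,
      S.coset i (S.rep k ζ i) = S.coset i (S.rep g ε i) →
        (S.flag g ε : Set S.Face) ∩ S.flag h δ ⊆ S.flag k ζ := by
    intro i hi k ζ hk a ha
    obtain ⟨x, hx⟩ := exists_coset a
    have hag := mem_flag.1 ha.1
    rcases hi a ha with h' | h' | h'
    · rw [h'] at hx; rw [hx]; exact coset_zero_mem _ _
    · rw [h', ← hk] at hag; rw [hag]; exact coset_rep_mem_flag _ _ _
    · rw [h'] at hx; rw [hx]; exact coset_four_mem _ _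
  have common : ∀ a ∈ (S.flag g ε : Set S.Face) ∩ S.flag h δ,
      S.coset a.idx (S.rep g ε a.idx) = S.coset a.idx (S.rep h δ a.idx) := fun a ha => by
    rw [← mem_flag.1 ha.1]; exact mem_flag.1 ha.2
  have split : ∀ i : Fin 5, i = 0 ∨ i = 1 ∨ i = 2 ∨ i = 3 ∨ i = 4 := by decide
  by_cases h1 : S.coset 1 (S.rep g ε 1) = S.coset 1 (S.rep h δ 1)
  · have h2 : S.coset 2 (S.rep g ε 2) ≠ S.coset 2 (S.rep h δ 2) := fun h2 => by
      have e := eq_or_of_vertex_of_edge h1 h2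
      rcases Bool.eq_or_eq_not δ ε with h' | h'
      · exact heq ⟨e, h'⟩
      · exact adj 2 ⟨e, h'⟩
    have h3 : S.coset 3 (S.rep g ε 3) ≠ S.coset 3 (S.rep h δ 3) := fun h3 =>
      (eq_or_of_vertex_of_face h1 h3).elim heq (adj 1)
    have hi := key 1 fun a ha => by
      have := common a ha
      rcases split a.idx with e | e | e | e | e <;> rw [e] at this <;> simp [e]
      exacts [h2 this, h3 this]
    have r1 : ∀ k ζ, S.rep k ζ 1 = k := fun k ζ => rep_of_ne (by decide) k ζ
    simp only [r1] at hi h1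
    exact conn_of_vertex hi h1
  by_cases h2 : S.coset 2 (S.rep g ε 2) = S.coset 2 (S.rep h δ 2)
  · have h3 : S.coset 3 (S.rep g ε 3) ≠ S.coset 3 (S.rep h δ 3) := fun h3 =>
      (eq_or_of_edge_of_face h2 h3).elim heq (adj 0)
    have hi := key 2 fun a ha => by
      have := common a ha
      rcases split a.idx with e | e | e | e | e <;> rw [e] at this <;> simp [e]
      exacts [h1 this, h3 this]
    have r1 : ∀ k ζ, S.rep k ζ 2 = k := fun k ζ => rep_of_ne (by decide) k ζ
    simp only [r1] at hi h2
    exact conn_of_edge hi h2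
  by_cases h3 : S.coset 3 (S.rep g ε 3) = S.coset 3 (S.rep h δ 3)
  · have hi := key 3 fun a ha => by
      have := common a ha
      rcases split a.idx with e | e | e | e | e <;> rw [e] at this <;> simp [e]
      exacts [h1 this, h2 this]
    exact conn_of_face hi h3
  · have hi := key 0 fun a ha => by
      have := common a ha
      rcases split a.idx with e | e | e | e | e <;> rw [e] at this <;> simp [e]
      exacts [h1 this, h2 this, h3 this]
    exact conn_univ (fun k ζ => hi k ζ (coset_zero_eq _ _)) _ _ _ _

/-! ### Sections: the diamond condition and the Schläfli type -/

lemma coset_lt_coset_iff {i j : Fin 5} {g h : G} :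
    S.coset i g < S.coset j h ↔ S.coset i g ≤ S.coset j h ∧ i < j := lt_iff

lemma disjoint_stab {i j : Fin 5} (h0 : 0 < i) (hij : i < j) (h4 : j < 4) {x : G}
    (hi : x ∈ S.stab i) (hj : x ∈ S.stab j) : x = 1 := by
  have : (i = 1 ∧ j = 2) ∨ (i = 1 ∧ j = 3) ∨ (i = 2 ∧ j = 3) := by
    clear hi hj; revert i j; decide
  rcases this with ⟨rfl, rfl⟩ | ⟨rfl, rfl⟩ | ⟨rfl, rfl⟩
  exacts [S.eq_one_of_mem₁₂ hi hj, S.inter _ hj hi, S.eq_one_of_mem₂₃ hi hj]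

lemma encard_range_coset [Finite G] {i j : Fin 5} (h : ∀ x ∈ S.stab i, x ∈ S.stab j → x = 1)
    (g : G) : (Set.range fun u : S.stab j => S.coset i (g * u)).encard =
      (Nat.card (S.stab j) : ℕ∞) := by
  rw [← Set.image_univ, Function.Injective.encard_image, Set.encard_univ,
    ENat.card_eq_coe_natCard]
  intro u v huv
  have h1 := coset_eq_coset_iff.1 huv
  simp only [mul_inv_rev, mul_assoc, inv_mul_cancel_left] at h1
  exact Subtype.ext (inv_mul_eq_one.1 (h _ h1 (mul_mem (inv_mem u.2) v.2)))

/-- The faces sought are the cosets of g u for u in `stab j`, and they are distinct because the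
stabilisers meet trivially. Taking j = 2 gives the diamond condition, taking j = 3 the size of a
face. -/
lemma encard_below [Finite G] {i j : Fin 5} (h0 : 0 < i) (hij : i < j) (h4 : j < 4) {a b : S.Face}
    (ha : a.idx = 0) (hb : b.idx = j) :
    {c : S.Face | rank c = (i : ℕ) - 1 ∧ a < c ∧ c < b}.encard =
      (Nat.card (S.stab j) : ℕ∞) := by
  obtain ⟨x, ha'⟩ := exists_coset a
  obtain ⟨g, hb'⟩ := exists_coset b
  rw [ha] at ha'
  rw [hb] at hb'
  rw [← encard_range_coset (i := i) (fun x hi hj => disjoint_stab h0 hij h4 hi hj) g]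
  congr 1
  ext c
  simp only [rank_eq_iff, Set.mem_ofPred_eq, Set.mem_range]
  constructor
  · rintro ⟨hc, -, hcb⟩
    obtain ⟨-, y, h1, h2⟩ := hcb.le
    rw [hc] at h1
    rw [hb, hb'] at h2
    obtain ⟨u, hu, rfl⟩ := exists_of_coset_eq h2
    exact ⟨⟨u, hu⟩, h1.symm⟩
  · rintro ⟨u, rfl⟩
    refine ⟨rfl, ?_, ?_⟩
    · rw [ha', coset_lt_coset_iff]
      exact ⟨coset_zero_le _ _, h0⟩
    · rw [hb', coset_lt_coset_iff, ← coset_mul_of_mem (g := g) u.2]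
      exact ⟨coset_le_coset hij.le _, hij⟩

lemma encard_above [Finite G] {i j : Fin 5} (h0 : 0 < j) (hji : j < i) (h4 : i < 4) {a b : S.Face}
    (ha : a.idx = j) (hb : b.idx = 4) :
    {c : S.Face | rank c = (i : ℕ) - 1 ∧ a < c ∧ c < b}.encard =
      (Nat.card (S.stab j) : ℕ∞) := by
  obtain ⟨g, ha'⟩ := exists_coset a
  obtain ⟨x, hb'⟩ := exists_coset b
  rw [ha] at ha'
  rw [hb] at hb'
  rw [← encard_range_coset (i := i) (fun x hi hj => disjoint_stab h0 hji h4 hj hi) g]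
  congr 1
  ext c
  simp only [rank_eq_iff, Set.mem_ofPred_eq, Set.mem_range]
  constructor
  · rintro ⟨hc, hac, -⟩
    obtain ⟨-, y, h1, h2⟩ := hac.le
    rw [hc] at h2
    rw [ha, ha'] at h1
    obtain ⟨u, hu, rfl⟩ := exists_of_coset_eq h1
    exact ⟨⟨u, hu⟩, h2.symm⟩
  · rintro ⟨u, rfl⟩
    refine ⟨rfl, ?_, ?_⟩
    · rw [ha', coset_lt_coset_iff, ← coset_mul_of_mem (g := g) u.2]
      exact ⟨coset_le_coset hji.le _, hji⟩
    · rw [hb', coset_lt_coset_iff]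
      exact ⟨le_coset_four _ _, h4⟩

/-- An edge between g⟨s₂⟩ and g⟨s₁⟩ contains some g u with u ∈ ⟨s₂⟩ such that u or uτ lies in ⟨s₁⟩.
Hence u = 1 or u = s₂. -/
lemma encard_edges {a b : S.Face} (ha : a.idx = 1) (hb : b.idx = 3) (hab : a ≤ b) :
    {c : S.Face | rank c = 1 ∧ a < c ∧ c < b}.encard = 2 := by
  obtain ⟨-, g, ha', hb'⟩ := hab
  rw [ha] at ha'
  rw [hb] at hb'
  have hne : S.coset 2 g ≠ S.coset 2 (g * S.s₂) := by
    rw [Ne, coset_eq_coset_iff, inv_mul_cancel_left]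
    exact fun h => S.s₂_ne (S.eq_one_of_mem₁₂ S.s₂_mem h)
  rw [← Set.encard_pair hne]
  congr 1
  ext c
  have hr : rank c = 1 ↔ c.idx = 2 := rank_eq_iff (i := 2)
  simp only [hr, Set.mem_ofPred_eq, Set.mem_insert_iff, Set.mem_singleton_iff]
  constructor
  · rintro ⟨hc, hac, hcb⟩
    obtain ⟨-, y, h1, h2⟩ := hac.le
    obtain ⟨-, z, h3, h4⟩ := hcb.le
    rw [hc] at h2 h3
    rw [ha, ha'] at h1
    rw [hb, hb'] at h4
    obtain ⟨u, hu, rfl⟩ := exists_of_coset_eq h1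
    rw [coset_eq_coset_iff] at h4
    rcases coset_two_eq_iff.1 (h2.symm.trans h3) with rfl | rfl
    · left
      rw [inv_mul_cancel_left] at h4
      rw [h2, S.inter u h4 hu, mul_one]
    · right
      rw [mul_assoc, inv_mul_cancel_left] at h4
      rw [h2, S.mul_τ_mem₁ hu h4]
  · rintro (rfl | rfl)
    · refine ⟨rfl, ?_, ?_⟩
      · rw [ha', coset_lt_coset_iff]
        exact ⟨coset_le_coset (by decide) _, by decide⟩
      · rw [hb', coset_lt_coset_iff]
        exact ⟨coset_le_coset (by decide) _, by decide⟩
    · refine ⟨rfl, ?_, ?_⟩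
      · have : S.coset 1 g = S.coset 1 (g * S.s₂) := (coset_mul_of_mem S.s₂_mem).symm
        rw [ha', this, coset_lt_coset_iff]
        exact ⟨coset_le_coset (by decide) _, by decide⟩
      · have : S.coset 3 g = S.coset 3 (g * S.s₂ * S.τ) := by
          rw [mul_assoc, s₂_mul_τ]
          exact (coset_mul_of_mem (inv_mem S.s₁_mem)).symm
        rw [hb', this, ← coset_two_mul_τ (g * S.s₂), coset_lt_coset_iff]
        exact ⟨coset_le_coset (by decide) _, by decide⟩

lemma orderOf_τ : orderOf S.τ = 2 :=
  orderOf_eq_prime (by rw [pow_two, S.τ_mul_self]) S.τ_ne_one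

lemma encard_flag (Φ : Flag S.Face) : (Φ : Set S.Face).encard = 5 := by
  obtain ⟨g, ε, rfl⟩ := exists_flag_eq Φ
  change (Set.range fun i => S.coset i (S.rep g ε i)).encard = 5
  rw [← Set.image_univ, Function.Injective.encard_image, Set.encard_univ]
  · simp
  · intro i j h
    exact idx_eq_of_coset_eq h

lemma diamond [Finite G] (i : ℤ) (h0 : 0 ≤ i) (h2 : i ≤ 2) (a b : S.Face) (ha : rank a = i - 1)
    (hb : rank b = i + 1) (hab : a ≤ b) :
    {c : S.Face | rank c = i ∧ a < c ∧ c < b}.encard = 2 := by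
  have hτ : (Nat.card (S.stab 2) : ℕ∞) = 2 := by
    rw [stab_two, Nat.card_zpowers, orderOf_τ]; rfl
  obtain rfl | rfl | rfl : i = 0 ∨ i = 1 ∨ i = 2 := by omega
  · rw [← hτ]
    exact encard_below (i := 1) (by decide) (by decide) (by decide)
      (rank_eq_iff.1 (by rw [ha]; rfl)) (rank_eq_iff.1 (by rw [hb]; rfl))
  · exact encard_edges (rank_eq_iff.1 (by rw [ha]; rfl)) (rank_eq_iff.1 (by rw [hb]; rfl)) hab
  · rw [← hτ]
    exact encard_above (i := 3) (by decide) (by decide) (by decide)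
      (rank_eq_iff.1 (by rw [ha]; rfl)) (rank_eq_iff.1 (by rw [hb]; rfl))

lemma range_rank : Set.range (rank : S.Face → ℤ) = Set.Icc (-1) 3 := by
  ext j
  simp only [Set.mem_range, Set.mem_Icc]
  constructor
  · rintro ⟨a, rfl⟩
    have := a.idx.2
    simp only [rank]
    omega
  · rintro ⟨h1, h2⟩
    refine ⟨S.coset ⟨(j + 1).toNat, by omega⟩ 1, ?_⟩
    simp only [rank_coset]
    omega

variable (S) in
/-- The polyhedron of a rotation pair. -/
abbrev polytope [Finite G] : AbstractPolytope.{0} 3 where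
  Face := S.Face
  rank := rank
  rank_strictMono := rank_strictMono
  rank_range := range_rank
  exists_least := ⟨S.coset 0 1, coset_zero_le 1⟩
  exists_greatest := ⟨S.coset 4 1, le_coset_four 1⟩
  flag_encard := encard_flag
  strongly_flag_connected := strongly_connected
  diamond i h0 h2 a b := diamond i h0 (by simpa using h2) a b

lemma hasSchlafliType [Finite G] :
    S.polytope.HasSchlafliType ![orderOf S.s₁, orderOf S.s₂] := by
  intro j a b ha hb hab
  fin_cases j
  · rw [← Nat.card_zpowers, ← Nat.card_zpowers]
    exact encard_below (i := 2) (j := 3) (by decide) (by decide) (by decide)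
      (rank_eq_iff.1 (ha.trans rfl)) (rank_eq_iff.1 (hb.trans rfl))
  · rw [← Nat.card_zpowers, ← Nat.card_zpowers]
    exact encard_above (i := 3) (j := 1) (by decide) (by decide) (by decide)
      (rank_eq_iff.1 (ha.trans rfl)) (rank_eq_iff.1 (hb.trans rfl))

/-- Sections of both kinds exist, so the type is determined. This is needed because `IsTight` only
asserts the existence of a type. -/
lemma hasSchlafliType_unique [Finite G] {k l : Fin 2 → ℕ} (hk : S.polytope.HasSchlafliType k)
    (hl : S.polytope.HasSchlafliType l) : k = l := by
  funext j
  have key : ∀ a b : S.Face, rank a = (j : ℤ) - 1 → rank b = (j : ℤ) + 2 → a ≤ b → k j = l j :=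
    fun a b ha hb hab => by exact_mod_cast (hk j a b ha hb hab).symm.trans (hl j a b ha hb hab)
  fin_cases j
  · exact key (S.coset 0 1) (S.coset 3 1) rfl rfl (coset_le_coset (by decide) _)
  · exact key (S.coset 1 1) (S.coset 4 1) rfl rfl (coset_le_coset (by decide) _)

/-! ### Automorphisms -/

lemma idx_map (φ : S.Face ≃o S.Face) (a : S.Face) : (φ a).idx = a.idx := by
  obtain ⟨i, g, rfl⟩ : ∃ i g, a = S.coset i g := ⟨_, exists_coset a⟩
  change (φ (S.coset i g)).idx = i
  have hlt : ∀ i j : Fin 5, i < j → (φ (S.coset i g)).idx < (φ (S.coset j g)).idx :=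
    fun i j hij => (lt_iff.1 (φ.lt_iff_lt.2 (coset_lt_coset_iff.2 ⟨coset_le_coset hij.le g, hij⟩))).2
  have h0 := hlt 0 1 (by decide)
  have h1 := hlt 1 2 (by decide)
  have h2 := hlt 2 3 (by decide)
  have h3 := hlt 3 4 (by decide)
  clear hlt
  fin_cases i <;> simp only [Fin.zero_eta, Fin.mk_one, Fin.reduceFinMk] <;> omega

lemma mem_smul_flag {φ : S.Face ≃o S.Face} {Φ : Flag S.Face} {a : S.Face} :
    a ∈ φ • Φ ↔ φ.symm a ∈ Φ := by
  change a ∈ φ '' (Φ : Set S.Face) ↔ _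
  constructor
  · rintro ⟨b, hb, rfl⟩
    simpa using hb
  · intro h
    exact ⟨_, h, φ.apply_symm_apply a⟩

lemma apply_mem_smul_flag {φ : S.Face ≃o S.Face} {Φ : Flag S.Face} {a : S.Face} :
    φ a ∈ φ • Φ ↔ a ∈ Φ := by rw [mem_smul_flag, φ.symm_apply_apply]

lemma jAdjacent_smul (φ : S.Face ≃o S.Face) {j : ℤ} {Φ Ψ : Flag S.Face}
    (h : FlagJAdjacent rank j Φ Ψ) : FlagJAdjacent rank j (φ • Φ) (φ • Ψ) := by
  refine ⟨fun e => h.1 (MulAction.injective φ e), fun F hF => ?_⟩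
  rw [mem_smul_flag, mem_smul_flag]
  exact h.2 _ (by rwa [rank, idx_map])

/-- Automorphisms preserve adjacency of each rank and the neighbour of a given rank is unique, so
knowledge of one flag's image propagates along paths. -/
lemma smul_flag_nbr {φ : S.Face ≃o S.Face} {g h : G} {ε δ : Bool}
    (H : φ • S.flag g ε = S.flag h δ) (i : Fin 3) :
    φ • S.flag (S.nbr g ε i) (!ε) = S.flag (S.nbr h δ i) (!δ) := by
  have h1 := jAdjacent_smul φ (jAdjacent_nbr g ε i)
  obtain ⟨k, ζ, hk⟩ := exists_flag_eq (φ • S.flag (S.nbr g ε i) (!ε))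
  rw [H, hk, jAdjacent_iff] at h1
  obtain ⟨rfl, i', hi, rfl⟩ := h1
  have : i = i' := Fin.ext (by exact_mod_cast hi)
  rw [hk, this]

instance : MulAction G S.Face where
  smul g a := ⟨a.1, g • a.2⟩
  one_smul a := congrArg (Sigma.mk a.1) (one_smul G a.2)
  mul_smul g h a := congrArg (Sigma.mk a.1) (mul_smul g h a.2)

lemma smul_le_smul (g : G) {a b : S.Face} (h : a ≤ b) : g • a ≤ g • b := by
  obtain ⟨h, x, ha, hb⟩ := h
  exact ⟨h, g * x, congrArg (g • ·) ha, congrArg (g • ·) hb⟩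

variable (S) in
/-- Left multiplication on the faces. -/
def leftMul (g : G) : S.Face ≃o S.Face where
  toEquiv := MulAction.toPerm g
  map_rel_iff' := ⟨fun h => by simpa using smul_le_smul g⁻¹ h, smul_le_smul g⟩

@[simp] lemma leftMul_coset (g h : G) (i : Fin 5) :
    S.leftMul g (S.coset i h) = S.coset i (g * h) := rfl

lemma leftMul_smul_flag (g h : G) (ε : Bool) :
    S.leftMul g • S.flag h ε = S.flag (g * h) ε := by
  refine flag_eq_of_forall_mem fun i => ?_
  have : S.coset i (S.rep (g * h) ε i) = S.leftMul g (S.coset i (S.rep h ε i)) := by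
    rw [leftMul_coset]
    congr 1
    simp only [rep]
    split_ifs <;> simp [mul_assoc]
  rw [this, apply_mem_smul_flag]
  exact coset_rep_mem_flag i h ε

lemma flag_smul_ext {φ ψ : S.Face ≃o S.Face}
    (h : ∀ g, φ • S.flag g false = ψ • S.flag g false) : φ = ψ := by
  ext a
  obtain ⟨g, ha⟩ := exists_coset a
  have hmem : a ∈ S.flag g false := by rw [mem_flag, rep_false]; exact ha
  refine eq_of_mem_of_idx (Φ := ψ • S.flag g false) ?_ ?_ (by rw [idx_map, idx_map])
  · rw [← h]; exact apply_mem_smul_flag.2 hmem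
  · exact apply_mem_smul_flag.2 hmem

/-- Right multiplication by a generator is a product of two adjacencies, so the image of the base
flag fixes the images of all flags. -/
lemma eq_leftMul {φ : S.Face ≃o S.Face} {a : G}
    (h : φ • S.flag 1 false = S.flag a false) : φ = S.leftMul a := by
  have flip : ∀ {g h}, φ • S.flag g false = S.flag h false →
      φ • S.flag g true = S.flag h true := fun H => smul_flag_nbr H 2
  have flip' : ∀ {g h}, φ • S.flag g true = S.flag h true →
      φ • S.flag g false = S.flag h false := fun H => smul_flag_nbr H 2
  refine flag_smul_ext fun g => ?_
  rw [leftMul_smul_flag]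
  have hg : g ∈ closure {S.s₂, S.s₁ * S.s₂} := S.generate ▸ mem_top g
  induction hg using closure_induction_right with
  | one => rwa [mul_one]
  | mul_right x hx y hy ih =>
    rw [← mul_assoc]
    rcases hy with rfl | rfl
    · exact flip' (smul_flag_nbr ih 1)
    · exact flip' (smul_flag_nbr ih 0)
  | mul_inv_cancel x hx y hy ih =>
    rw [← mul_assoc]
    rcases hy with rfl | rfl
    · exact smul_flag_nbr (flip ih) 1
    · have := S.τ_inv
      rw [τ] at this
      rw [this]
      exact flip' (smul_flag_nbr ih 0)

/-- An automorphism which takes the base flag to a flag in the other orbit under `G` inverts the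
generators of `G`. -/
lemma exists_hom_of_smul_flag {φ : S.Face ≃o S.Face} {a : G}
    (h : φ • S.flag 1 false = S.flag a true) :
    ∃ f : G →* G, f S.s₂ = S.s₂⁻¹ ∧ f (S.s₁ * S.s₂) = S.s₁ * S.s₂ := by
  have stepτ : ∀ {g h}, φ • S.flag g false = S.flag h true →
      φ • S.flag (g * S.τ) false = S.flag (h * S.τ) true := fun H =>
    smul_flag_nbr (smul_flag_nbr H 2) 0
  have steps : ∀ {g h}, φ • S.flag g false = S.flag h true →
      φ • S.flag (g * S.s₂) false = S.flag (h * S.s₂⁻¹) true := fun H =>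
    smul_flag_nbr (smul_flag_nbr H 1) 2
  have steps' : ∀ {g h}, φ • S.flag g false = S.flag h true →
      φ • S.flag (g * S.s₂⁻¹) false = S.flag (h * S.s₂) true := fun H =>
    smul_flag_nbr (smul_flag_nbr H 2) 1
  have gen : ∀ g, g ∈ closure {S.s₂, S.τ} := fun g => by
    have := S.generate
    rw [← τ_eq] at this
    exact this ▸ mem_top g
  -- The automorphism sends the whole `false` class into the `true` class. Writing the image of g as
  -- a * f g defines the homomorphism f.
  have ex : ∀ g, ∃ h, φ • S.flag g false = S.flag (a * h) true := by
    intro g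
    induction gen g using closure_induction_right with
    | one => exact ⟨1, by rwa [mul_one]⟩
    | mul_right x hx y hy ih =>
      obtain ⟨h, hh⟩ := ih
      rcases hy with rfl | rfl
      · exact ⟨_, by rw [← mul_assoc]; exact steps hh⟩
      · exact ⟨_, by rw [← mul_assoc]; exact stepτ hh⟩
    | mul_inv_cancel x hx y hy ih =>
      obtain ⟨h, hh⟩ := ih
      rcases hy with rfl | rfl
      · exact ⟨_, by rw [← mul_assoc]; exact steps' hh⟩
      · exact ⟨_, by rw [← mul_assoc, τ_inv]; exact stepτ hh⟩
  choose f hf using ex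
  have uniq : ∀ {g h}, φ • S.flag g false = S.flag (a * h) true → f g = h := fun H =>
    mul_left_cancel (flag_injective ((hf _).symm.trans H)).1
  have f1 : f 1 = 1 := uniq (by rwa [mul_one])
  have fτ : ∀ g, f (g * S.τ) = f g * S.τ := fun g =>
    uniq (by rw [← mul_assoc]; exact stepτ (hf g))
  have fs : ∀ g, f (g * S.s₂) = f g * S.s₂⁻¹ := fun g =>
    uniq (by rw [← mul_assoc]; exact steps (hf g))
  have fs' : ∀ g, f (g * S.s₂⁻¹) = f g * S.s₂ := fun g =>
    uniq (by rw [← mul_assoc]; exact steps' (hf g))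
  have es : f S.s₂ = S.s₂⁻¹ := by simpa [f1] using fs 1
  have eτ : f S.τ = S.τ := by simpa [f1] using fτ 1
  refine ⟨MonoidHom.mk' f fun x y => ?_, es, eτ⟩
  induction gen y using closure_induction_right with
  | one => rw [mul_one, f1, mul_one]
  | mul_right u hu y hy ih =>
    rcases hy with rfl | rfl
    · rw [← mul_assoc, fs, fs, ih, mul_assoc]
    · rw [← mul_assoc, fτ, fτ, ih, mul_assoc]
  | mul_inv_cancel u hu y hy ih =>
    rcases hy with rfl | rfl
    · rw [← mul_assoc, fs', fs', ih, mul_assoc]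
    · rw [← mul_assoc, τ_inv, fτ, fτ, ih, mul_assoc]

lemma leftMul_bijective
    (hS : ¬ ∃ f : G →* G, f S.s₂ = S.s₂⁻¹ ∧ f (S.s₁ * S.s₂) = S.s₁ * S.s₂) :
    Function.Bijective S.leftMul := by
  constructor
  · intro g h e
    have := leftMul_smul_flag (S := S) g 1 false
    rw [e, leftMul_smul_flag] at this
    simpa using (flag_injective this).1.symm
  · intro φ
    obtain ⟨a, ε, h⟩ := exists_flag_eq (φ • S.flag 1 false)
    cases ε
    · exact ⟨a, (eq_leftMul h).symm⟩
    · exact (hS (exists_hom_of_smul_flag h)).elim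

lemma card_aut [Finite G]
    (hS : ¬ ∃ f : G →* G, f S.s₂ = S.s₂⁻¹ ∧ f (S.s₁ * S.s₂) = S.s₁ * S.s₂) :
    Nat.card S.polytope.Aut = Nat.card G :=
  (Nat.card_eq_of_bijective _ (leftMul_bijective hS)).symm

lemma mem_orbit_iff
    (hS : ¬ ∃ f : G →* G, f S.s₂ = S.s₂⁻¹ ∧ f (S.s₁ * S.s₂) = S.s₁ * S.s₂)
    {g h : G} {ε δ : Bool} :
    S.flag g ε ∈ MulAction.orbit (S.Face ≃o S.Face) (S.flag h δ) ↔ ε = δ := by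
  constructor
  · rintro ⟨φ, hφ⟩
    obtain ⟨a, rfl⟩ := (leftMul_bijective hS).2 φ
    have := (leftMul_smul_flag a h δ).symm.trans hφ
    exact (flag_injective this).2.symm
  · rintro rfl
    exact ⟨S.leftMul (g * h⁻¹), (leftMul_smul_flag _ _ _).trans (by simp)⟩

lemma isChiral [Finite G]
    (hS : ¬ ∃ f : G →* G, f S.s₂ = S.s₂⁻¹ ∧ f (S.s₁ * S.s₂) = S.s₁ * S.s₂) :
    S.polytope.IsChiral := by
  constructor
  · have hb : Function.Bijective fun ε : Bool =>
        (Quotient.mk (MulAction.orbitRel (S.Face ≃o S.Face) (Flag S.Face)) (S.flag 1 ε)) := by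
      constructor
      · intro ε δ h
        exact (mem_orbit_iff hS).1 (MulAction.orbitRel_apply.1 (Quotient.exact h))
      · intro q
        induction q using Quotient.inductionOn with
        | h Φ =>
          obtain ⟨g, ε, rfl⟩ := exists_flag_eq Φ
          exact ⟨ε, Quotient.sound (MulAction.orbitRel_apply.2 ((mem_orbit_iff hS).2 rfl))⟩
    exact (Nat.card_eq_of_bijective _ hb).symm.trans (by simp)
  · rintro Φ Ψ ⟨j, h⟩ hmem
    obtain ⟨g, ε, rfl⟩ := exists_flag_eq Φ
    obtain ⟨k, δ, rfl⟩ := exists_flag_eq Ψ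
    have h1 := (jAdjacent_iff.1 h).1
    have h2 := (mem_orbit_iff hS).1 hmem
    rw [h2] at h1
    cases ε <;> simp at h1

lemma isTight_iff [Finite G]
    (hS : ¬ ∃ f : G →* G, f S.s₂ = S.s₂⁻¹ ∧ f (S.s₁ * S.s₂) = S.s₁ * S.s₂) :
    S.polytope.IsTight ↔ Nat.card G = orderOf S.s₁ * orderOf S.s₂ := by
  rw [AbstractPolytope.IsTight, card_aut hS]
  constructor
  · rintro ⟨k, l, h, hc⟩
    have := hasSchlafliType_unique h hasSchlafliType
    have h0 := congrFun this 0
    have h1 := congrFun this 1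
    simp at h0 h1
    rw [hc, h0, h1]
  · intro h
    exact ⟨_, _, hasSchlafliType, h⟩

end RotationPair

/-! ### The semidirect product of a ring and a dihedral group -/

open DihedralGroup

/-- A commutative ring `R` with an involution `bar` which inverts a unit `t` of order dividing `p`,
and a nonzero element `w` of additive order `p` with `t * w = w` and `bar w = -w`. -/
structure TwistedRing (p e : ℕ) (R : Type) [CommRing R] where
  /-- The unit acting as a rotation. -/
  t : Rˣ
  /-- The involution acting as a reflection. -/
  bar : R →+* R
  /-- The `p`-th power of the rotation in the group extension. -/
  w : R
  bar_bar : ∀ u, bar (bar u) = u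
  bar_t : bar t = (t⁻¹ : Rˣ)
  t_pow : t ^ p = 1
  t_w : t * w = w
  bar_w : bar w = -w
  w_ne : w ≠ 0
  p_w : (p : R) * w = 0
  p_norm : (p : R) * ∑ i ∈ Finset.range p, (t : R) ^ i = 0
  span : ∀ U : AddSubgroup R, 1 ∈ U → (∀ u ∈ U, t * u ∈ U) → U = ⊤
  addOrderOf_one : addOrderOf (1 : R) = p ^ e

namespace TwistedRing

variable {p e : ℕ} {R : Type} [CommRing R] (D : TwistedRing p e R)

lemma t_pow_sq : D.t ^ (p ^ 2) = 1 := by rw [pow_two, pow_mul, D.t_pow, one_pow]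

/-- The powers of `t`, with exponents in `ZMod (p ^ 2)`. -/
def powHom : ZMod (p ^ 2) →+ Additive Rˣ :=
  ZMod.lift (p ^ 2) ⟨zmultiplesHom (Additive Rˣ) (Additive.ofMul D.t), by
    rw [zmultiplesHom_apply, natCast_zsmul]
    exact D.t_pow_sq⟩

/-- The power of `t` with exponent `i`. -/
def pow (i : ZMod (p ^ 2)) : R := ((D.powHom i).toMul : Rˣ)

@[simp] lemma pow_zero : D.pow 0 = 1 := by simp [pow]

lemma pow_add (i j : ZMod (p ^ 2)) : D.pow (i + j) = D.pow i * D.pow j := by simp [pow]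

lemma pow_natCast (n : ℕ) : D.pow n = (D.t : R) ^ n := by
  have : D.powHom ((n : ℤ) : ZMod (p ^ 2)) = (n : ℤ) • Additive.ofMul D.t := by
    rw [powHom, ZMod.lift_coe]; rfl
  rw [Int.cast_natCast] at this
  rw [pow, this]
  simp

lemma pow_one : D.pow 1 = D.t := by simpa using D.pow_natCast 1

lemma pow_mul_pow_neg (i : ZMod (p ^ 2)) : D.pow i * D.pow (-i) = 1 := by
  rw [← pow_add, add_neg_cancel, pow_zero]

lemma bar_pow (i : ZMod (p ^ 2)) : D.bar (D.pow i) = D.pow (-i) := by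
  simp only [pow, map_neg, toMul_neg]
  change ((Units.map (D.bar : R →* R) (D.powHom i).toMul : Rˣ) : R) = _
  congr 1
  have h : (Units.map (D.bar : R →* R)) D.t = D.t⁻¹ := Units.ext D.bar_t
  obtain ⟨n, rfl⟩ := ZMod.intCast_surjective i
  have : (D.powHom ((n : ℤ) : ZMod (p ^ 2))).toMul = D.t ^ n := by
    rw [powHom, ZMod.lift_coe]; rfl
  rw [this, map_zpow, h, inv_zpow]

lemma pow_mul_w (i : ZMod (p ^ 2)) : D.pow i * D.w = D.w := by
  have h : ∀ n : ℕ, (D.t : R) ^ n * D.w = D.w := by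
    intro n
    induction n with
    | zero => simp
    | succ n ih => rw [_root_.pow_succ, mul_assoc, D.t_w, ih]
  obtain ⟨n, rfl⟩ := ZMod.intCast_surjective i
  rcases n with n | n
  · rw [Int.ofNat_eq_natCast, Int.cast_natCast, pow_natCast, h]
  · have h1 : D.pow (-((n + 1 : ℕ) : ZMod (p ^ 2))) * D.w = D.w := by
      have e : D.pow (((n + 1 : ℕ) : ZMod (p ^ 2))) * D.w = D.w := by rw [pow_natCast, h]
      nth_rw 1 [← e]
      rw [← mul_assoc, mul_comm (D.pow _), pow_mul_pow_neg, one_mul]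
    rw [Int.negSucc_eq]
    push_cast at h1 ⊢
    exact h1

/-- The action of the dihedral group on `R`. -/
def act (D : TwistedRing p e R) (d : DihedralGroup (p ^ 2)) (u : R) : R :=
  match d with
  | r i => D.pow i * u
  | sr i => D.bar (D.pow i * u)

@[simp] lemma act_r (i : ZMod (p ^ 2)) (u : R) : D.act (r i) u = D.pow i * u := rfl

@[simp] lemma act_sr (i : ZMod (p ^ 2)) (u : R) : D.act (sr i) u = D.bar (D.pow i * u) := rfl

@[simp] lemma act_one (u : R) : D.act 1 u = u := by
  rw [one_def, act_r, pow_zero, one_mul]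

lemma act_mul (d d' : DihedralGroup (p ^ 2)) (u : R) : D.act (d * d') u = D.act d (D.act d' u) := by
  rcases d with i | i <;> rcases d' with j | j
  · rw [r_mul_r, act_r, act_r, act_r, pow_add, mul_assoc]
  · rw [r_mul_sr, act_sr, act_r, act_sr, map_mul, map_mul, bar_pow, bar_pow, ← mul_assoc,
      ← pow_add]
    congr 2; ring
  · rw [sr_mul_r, act_sr, act_r, act_sr, pow_add, mul_assoc]
  · rw [sr_mul_sr, act_sr, act_r, act_sr, map_mul, D.bar_bar, ← mul_assoc, bar_pow, ← pow_add]
    congr 2; ring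

lemma act_add (d : DihedralGroup (p ^ 2)) (u v : R) :
    D.act d (u + v) = D.act d u + D.act d v := by
  rcases d with i | i <;> simp [mul_add]

@[simp] lemma act_zero (d : DihedralGroup (p ^ 2)) : D.act d 0 = 0 := by
  rcases d with i | i <;> simp

/-- The semidirect product of `R` and the dihedral group of order `2 * p ^ 2`. -/
@[ext]
structure Split (D : TwistedRing p e R) where
  /-- The translation part. -/
  u : R
  /-- The dihedral part. -/
  d : DihedralGroup (p ^ 2)

namespace Split

variable {D}

instance : Mul D.Split := ⟨fun x y => ⟨x.u + D.act x.d y.u, x.d * y.d⟩⟩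
instance : One D.Split := ⟨⟨0, 1⟩⟩
instance : Inv D.Split := ⟨fun x => ⟨D.act x.d⁻¹ (-x.u), x.d⁻¹⟩⟩

@[simp] lemma mk_mul_mk (u v : R) (d d' : DihedralGroup (p ^ 2)) :
    (⟨u, d⟩ * ⟨v, d'⟩ : D.Split) = ⟨u + D.act d v, d * d'⟩ := rfl

lemma one_eq : (1 : D.Split) = ⟨0, 1⟩ := rfl

instance : Group D.Split := Group.ofLeftAxioms
  (fun x y z => by
    obtain ⟨u, d⟩ := x; obtain ⟨v, d'⟩ := y; obtain ⟨w, d''⟩ := z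
    simp [act_add, act_mul, add_assoc, mul_assoc])
  (fun x => by obtain ⟨u, d⟩ := x; simp [one_eq])
  (fun x => by
    obtain ⟨u, d⟩ := x
    change (⟨D.act d⁻¹ (-u) + D.act d⁻¹ u, d⁻¹ * d⟩ : D.Split) = _
    simp [one_eq, ← act_add])

/-- `Split` is in bijection with the product. -/
def equivProd : D.Split ≃ R × DihedralGroup (p ^ 2) where
  toFun x := (x.u, x.d)
  invFun x := ⟨x.1, x.2⟩

instance [Finite R] [NeZero p] : Finite D.Split := Finite.of_equiv _ equivProd.symm

lemma card_eq : Nat.card D.Split = Nat.card R * (2 * p ^ 2) := by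
  rw [Nat.card_congr equivProd, Nat.card_prod, DihedralGroup.nat_card]

lemma mk_pow {u : R} {d : DihedralGroup (p ^ 2)} (h : D.act d u = u) (n : ℕ) :
    (⟨u, d⟩ : D.Split) ^ n = ⟨n * u, d ^ n⟩ := by
  induction n with
  | zero => simp [one_eq]
  | succ n ih =>
    have h2 : D.act d (n * u) = n * u := by
      clear ih
      induction n with
      | zero => simp
      | succ n ih => rw [Nat.cast_succ, add_mul, act_add, ih, one_mul, h]
    rw [pow_succ', ih, mk_mul_mk, h2, ← pow_succ', Nat.cast_succ]
    congr 1; ring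

lemma pow_rotation (n : ℕ) : (⟨1, r 1⟩ : D.Split) ^ n =
    ⟨∑ i ∈ Finset.range n, (D.t : R) ^ i, r n⟩ := by
  induction n with
  | zero => simp [one_eq]
  | succ n ih =>
    rw [pow_succ, ih, mk_mul_mk, Finset.sum_range_succ, act_r, pow_natCast, mul_one, r_mul_r]
    push_cast
    rfl

lemma sq_reflection : (⟨1, sr 0⟩ : D.Split) ^ 2 = ⟨2, 1⟩ := by
  rw [pow_two, mk_mul_mk, act_sr, sr_mul_sr]
  simp [one_add_one_eq_two]

lemma pow_reflection (n : ℕ) : (⟨1, sr 0⟩ : D.Split) ^ (2 * n) = ⟨n * 2, 1⟩ := by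
  rw [pow_mul, sq_reflection, mk_pow (by simp), one_pow]

lemma pow_reflection' (n : ℕ) : ((⟨1, sr 0⟩ : D.Split) ^ (2 * n + 1)).d = sr 0 := by
  have h : (⟨1, sr 0⟩ : D.Split) ^ (2 * n + 1) = ⟨n * 2, 1⟩ * ⟨1, sr 0⟩ := by
    rw [_root_.pow_succ, pow_reflection]
  rw [h, Split.mk_mul_mk, one_mul]

end Split

/-! ### The extension in which r^p equals w -/

/-- The element which is factored out of the semidirect product. -/
def κ : D.Split := ⟨D.w, r (-(p : ZMod (p ^ 2)))⟩

lemma κ_pow (n : ℕ) : D.κ ^ n = ⟨n * D.w, r (-(p : ZMod (p ^ 2)) * n)⟩ := by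
  rw [κ, Split.mk_pow (by rw [act_r, pow_mul_w]), r_pow]

lemma κ_pow_p : D.κ ^ p = 1 := by
  have : (p : ZMod (p ^ 2)) * p = 0 := by
    rw [← pow_two]; exact_mod_cast ZMod.natCast_self (p ^ 2)
  rw [κ_pow, D.p_w, neg_mul, this, neg_zero]; rfl

/-- Rotations commute with r^p and fix w, whereas reflections invert r^p and negate w. -/
lemma κ_conj (g : D.Split) : g * D.κ * g⁻¹ = D.κ ∨ g * D.κ * g⁻¹ = D.κ⁻¹ := by
  obtain ⟨u, d⟩ := g
  rcases d with i | i
  · left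
    rw [mul_inv_eq_iff_eq_mul, κ, Split.mk_mul_mk, Split.mk_mul_mk, act_r, act_r, pow_mul_w,
      r_mul_r, r_mul_r]
    have : D.pow (-(p : ZMod (p ^ 2))) = 1 := by
      have := D.pow_mul_pow_neg (p : ZMod (p ^ 2))
      rw [pow_natCast, ← Units.val_pow_eq_pow_val, D.t_pow] at this
      simpa using this
    rw [this, one_mul, add_comm, add_comm i]
  · right
    rw [mul_inv_eq_iff_eq_mul, eq_inv_mul_iff_mul_eq, κ, Split.mk_mul_mk, Split.mk_mul_mk, act_sr,
      act_r, pow_mul_w, D.bar_w, sr_mul_r, r_mul_sr]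
    have : D.pow (-(p : ZMod (p ^ 2))) = 1 := by
      have := D.pow_mul_pow_neg (p : ZMod (p ^ 2))
      rw [pow_natCast, ← Units.val_pow_eq_pow_val, D.t_pow] at this
      simpa using this
    rw [this]
    congr 1
    · ring
    · congr 1; ring

instance : (zpowers D.κ).Normal where
  conj_mem := by
    rintro _ ⟨n, rfl⟩ g
    change g * D.κ ^ n * g⁻¹ ∈ _
    rw [← conj_zpow]
    refine zpow_mem ?_ n
    rcases D.κ_conj g with h | h <;> rw [h]
    exacts [mem_zpowers _, inv_mem (mem_zpowers _)]

/-- The nonsplit extension: the quotient of the semidirect product by `⟨κ⟩`. -/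
abbrev Quot : Type := D.Split ⧸ zpowers D.κ

lemma mem_zpowers_κ [NeZero p] {x : D.Split} :
    x ∈ zpowers D.κ ↔ ∃ j : ℕ, x = ⟨j * D.w, r (-(p : ZMod (p ^ 2)) * j)⟩ := by
  have hfin : IsOfFinOrder D.κ :=
    isOfFinOrder_iff_pow_eq_one.2 ⟨p, Nat.pos_of_neZero p, D.κ_pow_p⟩
  rw [← hfin.mem_powers_iff_mem_zpowers, Submonoid.mem_powers_iff]
  simp only [κ_pow, eq_comm]

lemma orderOf_κ [Fact p.Prime] : orderOf D.κ = p :=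
  orderOf_eq_prime D.κ_pow_p fun h => D.w_ne (congrArg Split.u h)

lemma card_quot [Fact p.Prime] [Finite R] : Nat.card D.Quot = 2 * p * Nat.card R := by
  have hp := (Fact.out : p.Prime).pos
  have h := Subgroup.card_eq_card_quotient_mul_card_subgroup (zpowers D.κ)
  rw [Nat.card_zpowers, orderOf_κ, Split.card_eq] at h
  refine Nat.eq_of_mul_eq_mul_right hp (h.symm.trans ?_)
  ring

lemma natCast_mul_w_eq_zero_iff [Fact p.Prime] {n : ℕ} : (n : R) * D.w = 0 ↔ p ∣ n := by
  have : addOrderOf D.w = p := addOrderOf_eq_prime (by rw [nsmul_eq_mul, D.p_w]) D.w_ne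
  rw [← nsmul_eq_mul, ← addOrderOf_dvd_iff_nsmul_eq_zero, this]

lemma natCast_eq_zero_iff (D : TwistedRing p e R) {n : ℕ} : (n : R) = 0 ↔ p ^ e ∣ n := by
  rw [← D.addOrderOf_one, addOrderOf_dvd_iff_nsmul_eq_zero, nsmul_one]

lemma p_mul_natCast_eq_zero_iff [Fact p.Prime] {n : ℕ} : (p : ZMod (p ^ 2)) * n = 0 ↔ p ∣ n := by
  rw [← Nat.cast_mul, ZMod.natCast_eq_zero_iff, pow_two,
    Nat.mul_dvd_mul_iff_left (Fact.out : p.Prime).pos]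

/-- The translations in the extension. -/
def ι (u : R) : D.Quot := QuotientGroup.mk (⟨u, 1⟩ : D.Split)

lemma ι_add (u v : R) : D.ι (u + v) = D.ι u * D.ι v := by
  rw [ι, ι, ι, ← QuotientGroup.mk_mul, Split.mk_mul_mk, act_one, one_mul]

lemma ι_zero : D.ι 0 = 1 := rfl

lemma ι_neg (u : R) : D.ι (-u) = (D.ι u)⁻¹ := by
  rw [eq_inv_iff_mul_eq_one, ← ι_add, neg_add_cancel, ι_zero]

lemma ι_natCast_mul (n : ℕ) (u : R) : D.ι (n * u) = D.ι u ^ n := by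
  induction n with
  | zero => simp [ι_zero]
  | succ n ih => rw [Nat.cast_succ, add_mul, one_mul, ι_add, ih, pow_succ]

/-- Translations survive in the quotient: a power κ^j without dihedral part has p ∣ j, and then j w
= 0. -/
lemma mk_mem_zpowers_κ_iff [Fact p.Prime] {u : R} : (⟨u, 1⟩ : D.Split) ∈ zpowers D.κ ↔ u = 0 := by
  rw [mem_zpowers_κ]
  constructor
  · rintro ⟨j, h⟩
    have h1 := congrArg Split.u h
    have h2 := congrArg Split.d h
    simp only [one_def, r.injEq, neg_mul, zero_eq_neg] at h1 h2
    rw [p_mul_natCast_eq_zero_iff] at h2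
    rw [h1, D.natCast_mul_w_eq_zero_iff.2 h2]
  · rintro rfl
    exact ⟨0, by simp⟩

lemma ι_eq_one_iff [Fact p.Prime] {u : R} : D.ι u = 1 ↔ u = 0 := by
  rw [ι, QuotientGroup.eq_one_iff, mk_mem_zpowers_κ_iff]

/-- The dihedral elements in the extension. -/
def δ (d : DihedralGroup (p ^ 2)) : D.Quot := QuotientGroup.mk (⟨0, d⟩ : D.Split)

lemma δ_mul (d d' : DihedralGroup (p ^ 2)) : D.δ (d * d') = D.δ d * D.δ d' := by
  rw [δ, δ, δ, ← QuotientGroup.mk_mul, Split.mk_mul_mk, act_zero, add_zero]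

lemma δ_one : D.δ 1 = 1 := rfl

lemma δ_pow (d : DihedralGroup (p ^ 2)) (n : ℕ) : D.δ (d ^ n) = D.δ d ^ n := by
  induction n with
  | zero => simp [δ_one]
  | succ n ih => rw [pow_succ (D.δ d), ← ih, ← δ_mul, pow_succ]

lemma ι_mul_δ (u : R) (d : DihedralGroup (p ^ 2)) :
    D.ι u * D.δ d = QuotientGroup.mk (⟨u, d⟩ : D.Split) := by
  rw [ι, δ, ← QuotientGroup.mk_mul, Split.mk_mul_mk, act_zero, add_zero, one_mul]

lemma δ_mul_ι (u : R) (d : DihedralGroup (p ^ 2)) : D.δ d * D.ι u = D.ι (D.act d u) * D.δ d := by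
  rw [ι_mul_δ, ι, δ, ← QuotientGroup.mk_mul, Split.mk_mul_mk, zero_add, mul_one]

lemma δ_pow_p : D.δ (r 1) ^ p = D.ι D.w := by
  rw [← δ_pow, r_one_pow, δ, ι, QuotientGroup.eq]
  have : (⟨0, r p⟩ : D.Split)⁻¹ * ⟨D.w, 1⟩ = D.κ := by
    rw [inv_mul_eq_iff_eq_mul, κ, Split.mk_mul_mk, act_r, pow_mul_w, r_mul_r]
    simp
  rw [this]
  exact mem_zpowers _

/-! ### Generators, their orders, and chirality -/

/-- The inverse of the rotation about the base face. -/
def rot : D.Split := ⟨1, r 1⟩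

/-- The rotation about the base vertex. -/
def refl : D.Split := ⟨1, sr 0⟩

lemma rot_mul : D.rot * ⟨0, sr 1⟩ = D.refl := by
  rw [rot, refl, Split.mk_mul_mk, act_zero, r_mul_sr, add_zero, sub_self]

lemma rot_inv_mul : D.rot⁻¹ * D.refl = ⟨0, sr 1⟩ := by
  rw [inv_mul_eq_iff_eq_mul, rot_mul]

/-- As t^p = 1, bar sends t^i to t^(p-i) and permutes the summands. -/
lemma bar_norm [Fact p.Prime] : D.bar (∑ i ∈ Finset.range p, (D.t : R) ^ i) =
    ∑ i ∈ Finset.range p, (D.t : R) ^ i := by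
  have hp := (Fact.out : p.Prime).pos
  have ht : (D.t : R) ^ p = 1 := by rw [← Units.val_pow_eq_pow_val, D.t_pow, Units.val_one]
  have h1 : D.bar (∑ i ∈ Finset.range p, (D.t : R) ^ i) =
      ∑ i ∈ Finset.range p, (D.t : R) ^ (i + 1) := by
    rw [map_sum, ← Finset.sum_range_reflect (fun i => (D.t : R) ^ (i + 1))]
    refine Finset.sum_congr rfl fun i hi => ?_
    have hi := Finset.mem_range.1 hi
    rw [map_pow, D.bar_t]
    have e : p - 1 - i + 1 = p - i := by omega
    rw [e, ← Units.val_pow_eq_pow_val, ← Units.val_pow_eq_pow_val, inv_pow]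
    congr 1
    rw [inv_eq_iff_mul_eq_one, ← _root_.pow_add, Nat.add_sub_cancel' hi.le, D.t_pow]
  rw [h1]
  have h2 := Finset.sum_range_succ (fun i => (D.t : R) ^ i) p
  rw [Finset.sum_range_succ', ht, _root_.pow_zero] at h2
  exact add_right_cancel h2

lemma rot_pow_p_mul (n : ℕ) : D.rot ^ (p * n) =
    ⟨n * ∑ i ∈ Finset.range p, (D.t : R) ^ i, r (p * n)⟩ := by
  have ht : (D.t : R) ^ p = 1 := by rw [← Units.val_pow_eq_pow_val, D.t_pow, Units.val_one]
  rw [rot, pow_mul, Split.pow_rotation, Split.mk_pow, r_pow]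
  rw [act_r, pow_natCast, ht, one_mul]

lemma dvd_of_bar_eq [Fact p.Prime] (hp : p ≠ 2) {u v : R} {j : ℕ} (hu : D.bar u = u) (hv : D.bar v = v)
    (h : u = v + j * D.w) : p ∣ j := by
  have h1 := congrArg D.bar h
  rw [hu, map_add, hv, map_mul, map_natCast, D.bar_w] at h1
  have h2 : ((2 * j : ℕ) : R) * D.w = 0 := by
    push_cast
    linear_combination h1 - h
  rw [natCast_mul_w_eq_zero_iff, (Fact.out : p.Prime).dvd_mul] at h2
  refine h2.resolve_left fun h => hp ?_
  exact (Nat.prime_dvd_prime_iff_eq Fact.out Nat.prime_two).1 h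

/-- This carries the intersection condition. Even powers of `refl` are translations, so i ≡ pj
modulo p² for the exponent j of κ. Both translation parts are fixed by bar while j w is negated,
which forces p ∣ j. Odd powers of `refl` are reflections and cannot match a rotation. -/
lemma mk_eq_one_of_pow [Fact p.Prime] (hp : p ≠ 2) {i l : ℕ}
    (h : (QuotientGroup.mk (D.rot ^ i) : D.Quot) = QuotientGroup.mk (D.refl ^ l)) :
    p ^ 2 ∣ i := by
  rw [QuotientGroup.eq, mem_zpowers_κ] at h
  obtain ⟨j, h⟩ := h
  rw [inv_mul_eq_iff_eq_mul] at h
  have hd := congrArg Split.d h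
  have hu := congrArg Split.u h
  rcases Nat.even_or_odd' l with ⟨n, rfl | rfl⟩
  · rw [refl, Split.pow_reflection, rot, Split.pow_rotation, Split.mk_mul_mk, r_mul_r] at hd
    simp only [one_def, r.injEq] at hd
    have h1 : (i : ZMod (p ^ 2)) = p * j := by linear_combination -hd
    have hpi : p ∣ i := by
      have h2 := congrArg (ZMod.castHom (Dvd.intro_left p (pow_two p).symm) (ZMod p)) h1
      rw [map_mul, map_natCast, map_natCast, ZMod.natCast_self, zero_mul] at h2
      exact (ZMod.natCast_eq_zero_iff _ _).1 h2
    obtain ⟨i', rfl⟩ := hpi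
    rw [refl, Split.pow_reflection, rot_pow_p_mul, Split.mk_mul_mk, act_r] at hu
    simp only at hu
    rw [mul_left_comm, pow_mul_w] at hu
    have hj : p ∣ j := D.dvd_of_bar_eq hp (by rw [map_mul, map_natCast, map_ofNat]) (by rw [map_mul, map_natCast, bar_norm]) hu
    rw [p_mul_natCast_eq_zero_iff.2 hj] at h1
    exact (ZMod.natCast_eq_zero_iff _ _).1 h1
  · rw [refl, Split.pow_reflection', rot, Split.pow_rotation, Split.mk_mul_mk, r_mul_r] at hd
    simp at hd

lemma rot_pow_sq : D.rot ^ (p ^ 2) = 1 := by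
  rw [pow_two, rot_pow_p_mul, D.p_norm, ← Nat.cast_mul, ← pow_two, ZMod.natCast_self]
  rfl

lemma orderOf_rot [Fact p.Prime] (hp : p ≠ 2) : orderOf (QuotientGroup.mk D.rot : D.Quot) = p ^ 2 := by
  refine Nat.dvd_antisymm (orderOf_dvd_of_pow_eq_one ?_) (D.mk_eq_one_of_pow hp (l := 0) ?_)
  · rw [← QuotientGroup.mk_pow, rot_pow_sq]; rfl
  · rw [QuotientGroup.mk_pow, pow_orderOf_eq_one]; rfl

lemma orderOf_refl [Fact p.Prime] (hp : p ≠ 2) : orderOf (QuotientGroup.mk D.refl : D.Quot) = 2 * p ^ e := by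
  refine Nat.dvd_right_iff_eq.1 fun l => ?_
  rw [orderOf_dvd_iff_pow_eq_one, ← QuotientGroup.mk_pow, QuotientGroup.eq_one_iff, refl]
  rcases Nat.even_or_odd' l with ⟨n, rfl | rfl⟩
  · have hcop : Nat.Coprime (p ^ e) 2 := Nat.Coprime.pow_left _
      ((Nat.coprime_primes Fact.out Nat.prime_two).2 hp)
    rw [Split.pow_reflection, mk_mem_zpowers_κ_iff, Nat.mul_dvd_mul_iff_left two_pos,
      ← hcop.dvd_mul_right, ← D.natCast_eq_zero_iff]
    push_cast; rfl
  · constructor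
    · intro h
      rw [mem_zpowers_κ] at h
      obtain ⟨j, h⟩ := h
      have := congrArg Split.d h
      rw [Split.pow_reflection'] at this
      simp at this
    · intro h
      have := (Dvd.intro _ rfl : 2 ∣ 2 * p ^ e).trans h
      omega

/-- The odd number p^e vanishes in R. The inverse of 2 is taken as a natural number because it
serves as an exponent. -/
lemma exists_two_mul_eq_one [Fact p.Prime] (D : TwistedRing p e R) (hp : p ≠ 2) : ∃ c : ℕ, (c : R) * 2 = 1 := by
  have ho : Odd (p ^ e) := ((Fact.out : p.Prime).odd_of_ne_two hp).pow
  obtain ⟨c, hc⟩ := ho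
  refine ⟨c + 1, ?_⟩
  have : ((2 * c + 1 : ℕ) : R) = 0 := by rw [← hc, D.natCast_eq_zero_iff]
  push_cast at this ⊢
  linear_combination this

lemma mk_refl : (QuotientGroup.mk D.refl : D.Quot) = D.ι 1 * D.δ (sr 0) := (D.ι_mul_δ _ _).symm

lemma mk_refl_sq : (QuotientGroup.mk D.refl : D.Quot) ^ 2 = D.ι 2 := by
  rw [← QuotientGroup.mk_pow, refl, Split.sq_reflection, ι]

lemma ι_t_mul (u : R) : D.ι (D.t * u) = D.δ (r 1) * D.ι u * (D.δ (r 1))⁻¹ := by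
  rw [δ_mul_ι, mul_inv_cancel_right, act_r, pow_one]

/-- The square of `refl` is translation by 2, so one of its powers is translation by 1. This splits
off sr 0 and hence r 1, and conjugation by r 1 is multiplication by t, so `span` yields all
translations. -/
lemma closure_eq_top [Fact p.Prime] (hp : p ≠ 2) :
    closure {(QuotientGroup.mk D.refl : D.Quot), D.δ (sr 1)} = ⊤ := by
  set H := closure {(QuotientGroup.mk D.refl : D.Quot), D.δ (sr 1)} with hH
  have m1 : (QuotientGroup.mk D.refl : D.Quot) ∈ H := subset_closure (by simp)
  have m2 : D.δ (sr 1) ∈ H := subset_closure (by simp)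
  obtain ⟨c, hc⟩ := D.exists_two_mul_eq_one hp
  have i1 : D.ι 1 ∈ H := by
    rw [← hc, ι_natCast_mul, ← mk_refl_sq]
    exact pow_mem (pow_mem m1 2) c
  have hs : D.δ (sr 0) ∈ H := by
    rw [mk_refl] at m1
    exact (H.mul_mem_cancel_left i1).1 m1
  have hr : D.δ (r 1) ∈ H := by
    have : D.δ (r 1) = D.δ (sr 0) * D.δ (sr 1) := by rw [← δ_mul, sr_mul_sr, sub_zero]
    rw [this]
    exact mul_mem hs m2
  let U : AddSubgroup R :=
    { carrier := {u | D.ι u ∈ H}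
      zero_mem' := one_mem H
      add_mem' := fun {a b} ha hb => by
        change D.ι (a + b) ∈ H
        rw [ι_add]; exact mul_mem ha hb
      neg_mem' := fun {a} ha => by
        change D.ι (-a) ∈ H
        rw [ι_neg]; exact inv_mem ha }
  have hU : U = ⊤ := D.span U i1 fun u hu => by
    change D.ι (D.t * u) ∈ H
    rw [ι_t_mul]
    exact mul_mem (mul_mem hr hu) (inv_mem hr)
  have hι : ∀ u, D.ι u ∈ H := fun u => by
    have : u ∈ U := hU ▸ AddSubgroup.mem_top u
    exact this
  have hri : ∀ i, D.δ (r i) ∈ H := fun i => by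
    obtain ⟨n, rfl⟩ := ZMod.natCast_zmod_surjective i
    rw [← r_one_pow, δ_pow]
    exact pow_mem hr n
  rw [eq_top_iff]
  intro x _
  obtain ⟨⟨u, d⟩, rfl⟩ := QuotientGroup.mk_surjective x
  rw [← ι_mul_δ]
  refine mul_mem (hι u) ?_
  rcases d with i | i
  · exact hri i
  · have : D.δ (sr i) = D.δ (sr 0) * D.δ (r i) := by rw [← δ_mul, sr_mul_r, zero_add]
    rw [this]
    exact mul_mem hs (hri i)

/-- The extension is chiral with respect to the generators. -/
lemma not_exists_hom [Fact p.Prime] (hp : p ≠ 2) : ¬ ∃ f : D.Quot →* D.Quot,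
    f (QuotientGroup.mk D.refl) = (QuotientGroup.mk D.refl)⁻¹ ∧ f (D.δ (sr 1)) = D.δ (sr 1) := by
  rintro ⟨f, h1, h2⟩
  have i2 : f (D.ι 2) = (D.ι 2)⁻¹ := by rw [← mk_refl_sq, map_pow, h1, inv_pow]
  obtain ⟨c, hc⟩ := D.exists_two_mul_eq_one hp
  have i1 : f (D.ι 1) = (D.ι 1)⁻¹ := by
    rw [← hc, ι_natCast_mul, map_pow, i2, inv_pow]
  have i2' : D.ι 2 = D.ι 1 * D.ι 1 := by rw [← ι_add, one_add_one_eq_two]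
  have hrot : (QuotientGroup.mk D.refl : D.Quot) * D.δ (sr 1) = D.ι 1 * D.δ (r 1) := by
    rw [mk_refl, mul_assoc, ← δ_mul, sr_mul_sr, sub_zero]
  -- Apply f to `hrot`: since the inverse of `refl` is (ι 2)⁻¹ times `refl`, both sides acquire the
  -- same factor (ι 1)⁻¹.
  have hr : f (D.δ (r 1)) = D.δ (r 1) := by
    have e := congrArg f hrot
    have e2 : (QuotientGroup.mk D.refl : D.Quot)⁻¹ =
        (D.ι 2)⁻¹ * (QuotientGroup.mk D.refl : D.Quot) := by
      rw [← mk_refl_sq, pow_two, mul_inv_rev, inv_mul_cancel_right]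
    rw [map_mul, map_mul, h1, h2, i1, e2, mul_assoc, hrot, i2', mul_inv_rev, mul_assoc,
      inv_mul_cancel_left] at e
    exact (mul_left_cancel e).symm
  let U : AddSubgroup R :=
    { carrier := {u | f (D.ι u) = D.ι (-u)}
      zero_mem' := by
        change f (D.ι 0) = D.ι (-0)
        rw [neg_zero, ι_zero, map_one]
      add_mem' := fun {a b} ha hb => by
        change f (D.ι (a + b)) = D.ι (-(a + b))
        rw [ι_add, map_mul, ha, hb, neg_add, ι_add]
      neg_mem' := fun {a} ha => by
        change f (D.ι (-a)) = D.ι (- -a)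
        rw [ι_neg, map_inv, ha, ← ι_neg] }
  have hU : U = ⊤ := by
    refine D.span U (i1.trans (D.ι_neg 1).symm) fun u hu => ?_
    change f (D.ι (D.t * u)) = D.ι (-(D.t * u))
    change f (D.ι u) = D.ι (-u) at hu
    rw [← mul_neg, ι_t_mul, ι_t_mul, map_mul, map_mul, map_inv, hr, hu]
  have hw : f (D.ι D.w) = D.ι (-D.w) := by
    have : D.w ∈ U := hU ▸ AddSubgroup.mem_top _
    exact this
  -- Here f negates w as a translation but fixes it as r^p.
  rw [← δ_pow_p, map_pow, hr, δ_pow_p, ι_neg, eq_inv_iff_mul_eq_one, ← ι_add, ι_eq_one_iff] at hw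
  have : ((2 : ℕ) : R) * D.w = 0 := by
    push_cast
    linear_combination hw
  rw [natCast_mul_w_eq_zero_iff] at this
  exact hp ((Nat.prime_dvd_prime_iff_eq Fact.out Nat.prime_two).1 this)

/-- The generating rotations of the extension. -/
def rotationPair [Fact p.Prime] [Finite R] (hp : p ≠ 2) : RotationPair D.Quot where
  s₁ := (QuotientGroup.mk D.rot)⁻¹
  s₂ := QuotientGroup.mk D.refl
  half_turn := by
    rw [← QuotientGroup.mk_inv, ← QuotientGroup.mk_mul, rot_inv_mul]
    exact (D.δ_mul _ _).symm.trans (by rw [sr_mul_self, δ_one])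
  inter := by
    intro x h1 h2
    rw [zpowers_inv, ← mem_powers_iff_mem_zpowers] at h1
    rw [← mem_powers_iff_mem_zpowers] at h2
    obtain ⟨i, hi⟩ := h1
    obtain ⟨l, hl⟩ := h2
    obtain ⟨n, rfl⟩ := D.mk_eq_one_of_pow hp (i := i) (l := l) (hi.trans hl.symm)
    change (QuotientGroup.mk D.rot : D.Quot) ^ (p ^ 2 * n) = x at hi
    rw [← hi, pow_mul, ← D.orderOf_rot hp, pow_orderOf_eq_one, one_pow]
  s₁_ne := by
    rw [Ne, inv_eq_one, ← orderOf_eq_one_iff, D.orderOf_rot hp]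
    exact fun h => (Fact.out : p.Prime).ne_one ((Nat.pow_eq_one.1 h).resolve_right two_ne_zero)
  s₂_ne := by
    rw [Ne, ← orderOf_eq_one_iff, D.orderOf_refl hp]
    omega
  generate := by
    rw [← QuotientGroup.mk_inv, ← QuotientGroup.mk_mul, rot_inv_mul]
    exact D.closure_eq_top hp

lemma exists_chiral_polyhedron [Fact p.Prime] [Finite R] (D : TwistedRing p e R) (hp : p ≠ 2) : ∃ P : AbstractPolytope.{0} 3,
    P.IsChiral ∧ (P.IsTight ↔ 2 * p * Nat.card R = p ^ 2 * (2 * p ^ e)) ∧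
    Nat.card P.Aut = 2 * p * Nat.card R ∧ P.HasSchlafliType ![p ^ 2, 2 * p ^ e] := by
  have hS : ¬ ∃ f : D.Quot →* D.Quot, f (D.rotationPair hp).s₂ = (D.rotationPair hp).s₂⁻¹ ∧
      f ((D.rotationPair hp).s₁ * (D.rotationPair hp).s₂) =
        (D.rotationPair hp).s₁ * (D.rotationPair hp).s₂ := by
    have : (D.rotationPair hp).s₁ * (D.rotationPair hp).s₂ = D.δ (sr 1) := by
      change (QuotientGroup.mk D.rot : D.Quot)⁻¹ * QuotientGroup.mk D.refl = _
      rw [← QuotientGroup.mk_inv, ← QuotientGroup.mk_mul, rot_inv_mul]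
      rfl
    rw [this]
    exact D.not_exists_hom hp
  have o1 : orderOf (D.rotationPair hp).s₁ = p ^ 2 := (orderOf_inv _).trans (D.orderOf_rot hp)
  have o2 : orderOf (D.rotationPair hp).s₂ = 2 * p ^ e := D.orderOf_refl hp
  refine ⟨(D.rotationPair hp).polytope, RotationPair.isChiral hS, ?_, ?_, ?_⟩
  · rw [RotationPair.isTight_iff hS, o1, o2, card_quot]
  · rw [RotationPair.card_aut hS, card_quot]
  · rw [← o1, ← o2]
    exact RotationPair.hasSchlafliType

end TwistedRing

open NumberField

/-! ### The ring of integers of a cyclotomic field of prime conductor -/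

namespace CyclotomicInt

variable (p : ℕ) [hp : Fact p.Prime]

instance : IsCyclotomicExtension {p} ℚ (CyclotomicField p ℚ) :=
  have : NeZero (p : ℚ) := ⟨Nat.cast_ne_zero.2 hp.out.ne_zero⟩
  CyclotomicField.isCyclotomicExtension p ℚ

/-- The ring of integers of the `p`-th cyclotomic field. -/
abbrev O : Type := 𝓞 (CyclotomicField p ℚ)

lemma spec : IsPrimitiveRoot (IsCyclotomicExtension.zeta p ℚ (CyclotomicField p ℚ)) p :=
  IsCyclotomicExtension.zeta_spec p ℚ (CyclotomicField p ℚ)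

/-- A primitive `p`-th root of unity. -/
noncomputable def z : O p := (spec p).toInteger

lemma z_spec : IsPrimitiveRoot (z p) p := (spec p).toInteger_isPrimitiveRoot

lemma z_pow : z p ^ p = 1 := (z_spec p).pow_eq_one

/-- The inverse of `z`. -/
noncomputable def zi : O p := z p ^ (p - 1)

lemma z_mul_zi : z p * zi p = 1 := by
  rw [zi, ← pow_succ', Nat.sub_add_cancel hp.out.one_le, z_pow]

lemma prime_lam : Prime (z p - 1) := (spec p).zeta_sub_one_prime'

lemma associated_p : Associated ((z p - 1) ^ (p - 1)) (p : O p) :=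
  IsCyclotomicExtension.Rat.associated_zeta_sub_one_pow_prime p (spec p)

lemma geom_sum : ∑ i ∈ Finset.range p, z p ^ i = 0 :=
  (z_spec p).geom_sum_eq_zero hp.out.one_lt

lemma span (U : AddSubgroup (O p)) (h1 : 1 ∈ U) (hz : ∀ u ∈ U, z p * u ∈ U) : U = ⊤ := by
  have hpow : ∀ n, z p ^ n ∈ U := by
    intro n
    induction n with
    | zero => simpa
    | succ n ih => rw [pow_succ']; exact hz _ ih
  rw [eq_top_iff]
  intro x _
  have hx : x ∈ Algebra.adjoin ℤ {z p} := by
    have := (spec p).integralPowerBasis.adjoin_gen_eq_top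
    rw [IsPrimitiveRoot.integralPowerBasis_gen] at this
    change Algebra.adjoin ℤ {z p} = ⊤ at this
    rw [this]
    trivial
  rw [Algebra.adjoin_singleton_eq_range_aeval] at hx
  obtain ⟨f, rfl⟩ := hx
  change Polynomial.aeval (z p) f ∈ U
  rw [Polynomial.aeval_eq_sum_range]
  exact U.sum_mem fun i _ => U.zsmul_mem (hpow i) _

/-- Complex conjugation. -/
noncomputable def conj : O p →ₐ[ℤ] O p :=
  (spec p).integralPowerBasis.lift (zi p) (by
    rw [IsPrimitiveRoot.integralPowerBasis_gen]
    change Polynomial.aeval (zi p) (minpoly ℤ (z p)) = 0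
    -- The inverse of z is its power with exponent p - 1, prime to p, hence a conjugate of z.
    have hcop : Nat.Coprime (p - 1) p := by
      rw [Nat.coprime_comm, Nat.coprime_self_sub_right hp.out.one_le]
      exact Nat.coprime_one_right p
    rw [(z_spec p).minpoly_eq_pow_coprime hcop]
    exact minpoly.aeval _ _)

lemma conj_z : conj p (z p) = zi p := by
  have h : (spec p).integralPowerBasis.gen = z p := IsPrimitiveRoot.integralPowerBasis_gen _
  exact (congrArg (conj p) h).symm.trans ((spec p).integralPowerBasis.lift_gen _ _)

lemma conj_zi : conj p (zi p) = z p := by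
  have h := congrArg (conj p) (z_mul_zi p)
  rw [map_mul, conj_z, map_one] at h
  calc conj p (zi p) = z p * zi p * conj p (zi p) := by rw [z_mul_zi, one_mul]
    _ = z p := by rw [mul_assoc, h, mul_one]

lemma conj_conj (x : O p) : conj p (conj p x) = x := by
  let U : AddSubgroup (O p) := AddMonoidHom.eqLocus
    (((conj p).comp (conj p) : O p →ₐ[ℤ] O p) : O p →+ O p) (AddMonoidHom.id _)
  have hU : U = ⊤ := span p U (by change conj p (conj p 1) = 1; simp) fun u hu => by
    change conj p (conj p (z p * u)) = z p * u
    change conj p (conj p u) = u at hu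
    rw [map_mul, map_mul, conj_z, conj_zi, hu]
  have : x ∈ U := hU ▸ AddSubgroup.mem_top x
  exact this

/-! ### The prime z - 1: residue field, divisibility and conjugation -/

lemma card_quotient (hp2 : p ≠ 2) (k : ℕ) :
    Nat.card (O p ⧸ Ideal.span {(z p - 1) ^ k}) = p ^ k := by
  rw [← Submodule.cardQuot_apply, ← Ideal.absNorm_apply, Ideal.absNorm_span_singleton, map_pow]
  have : Algebra.norm ℤ (z p - 1) = p :=
    (spec p).norm_toInteger_sub_one_of_prime_ne_two' hp2
  rw [this, Int.natAbs_pow, Int.natAbs_natCast]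

lemma exists_residue (hp2 : p ≠ 2) :
    ∃ χ : O p →+* ZMod p, ∀ x, χ x = 0 ↔ z p - 1 ∣ x := by
  have hcard := card_quotient p hp2 1
  rw [pow_one, pow_one] at hcard
  have : Finite (O p ⧸ Ideal.span {z p - 1}) :=
    Nat.finite_of_card_ne_zero (by rw [hcard]; exact hp.out.ne_zero)
  have := Fintype.ofFinite (O p ⧸ Ideal.span {z p - 1})
  rw [Nat.card_eq_fintype_card] at hcard
  let E := ZMod.ringEquivOfPrime (O p ⧸ Ideal.span {z p - 1}) hp.out hcard
  refine ⟨E.symm.toRingHom.comp (Ideal.Quotient.mk _), fun x => ?_⟩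
  rw [RingHom.comp_apply, RingEquiv.toRingHom_eq_coe, RingHom.coe_coe, map_eq_zero_iff _ E.symm.injective,
    Ideal.Quotient.eq_zero_iff_mem, Ideal.mem_span_singleton]

lemma lam_pow_dvd_iff {j k : ℕ} : (z p - 1) ^ k ∣ (z p - 1) ^ j ↔ k ≤ j :=
  pow_dvd_pow_iff (prime_lam p).ne_zero (prime_lam p).not_isUnit

lemma lam_pow_dvd_p_pow_iff {k n : ℕ} : (z p - 1) ^ k ∣ (p : O p) ^ n ↔ k ≤ (p - 1) * n := by
  rw [← ((associated_p p).pow_pow (n := n)).dvd_iff_dvd_right, ← pow_mul, lam_pow_dvd_iff]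

lemma lam_dvd_p : z p - 1 ∣ (p : O p) := by
  have := (lam_pow_dvd_p_pow_iff p (k := 1) (n := 1)).2 (by have := hp.out.two_le; omega)
  simpa using this

lemma conj_lam : conj p (z p - 1) = -zi p * (z p - 1) := by
  rw [map_sub, conj_z, map_one]
  linear_combination z_mul_zi p

/-- Conjugation multiplies z - 1 by -z⁻¹, which is -1 modulo z - 1, so it acts on the odd power k -
1 by the sign -1 modulo the next power. -/
lemma lam_pow_dvd_conj_add {k : ℕ} (hk : Even k) (hk0 : k ≠ 0) :
    (z p - 1) ^ k ∣ conj p ((z p - 1) ^ (k - 1)) + (z p - 1) ^ (k - 1) := by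
  have hodd : Odd (k - 1) := Nat.Even.sub_odd (by omega) hk odd_one
  have h1 : z p - 1 ∣ zi p ^ (k - 1) - 1 := by
    have : z p - 1 ∣ zi p - 1 := sub_one_dvd_pow_sub_one _ _
    exact this.trans (sub_one_dvd_pow_sub_one _ _)
  obtain ⟨c, hc⟩ := h1
  refine ⟨-c, ?_⟩
  have e : (z p - 1) ^ k = (z p - 1) ^ (k - 1) * (z p - 1) := by
    rw [← pow_succ, Nat.sub_add_cancel (by omega)]
  rw [map_pow, conj_lam, mul_pow, hodd.neg_pow, e]
  linear_combination -(z p - 1) ^ (k - 1) * hc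

/-! ### Truncations of the ring of integers -/

/-- The ideal generated by the `k`-th power of `z - 1`. -/
noncomputable def I (k : ℕ) : Ideal (O p) := Ideal.span {(z p - 1) ^ k}

lemma mem_I {k : ℕ} {x : O p} : x ∈ I p k ↔ (z p - 1) ^ k ∣ x := Ideal.mem_span_singleton

lemma mk_eq_zero_iff {k : ℕ} {x : O p} :
    Ideal.Quotient.mk (I p k) x = 0 ↔ (z p - 1) ^ k ∣ x := by
  rw [Ideal.Quotient.eq_zero_iff_mem, mem_I]

lemma I_le_comap (k : ℕ) : I p k ≤ (I p k).comap (conj p : O p →+* O p) := by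
  intro x hx
  rw [mem_I] at hx
  rw [Ideal.mem_comap, mem_I]
  refine Dvd.dvd.trans ?_ (map_dvd (conj p : O p →+* O p) hx)
  rw [map_pow]
  refine pow_dvd_pow_of_dvd ?_ k
  change _ ∣ conj p (z p - 1)
  rw [conj_lam]
  exact Dvd.intro_left _ rfl

/-- Complex conjugation modulo a power of `z - 1`. -/
noncomputable def conjMod (k : ℕ) : O p ⧸ I p k →+* O p ⧸ I p k :=
  Ideal.quotientMap (I p k) (conj p : O p →+* O p) (I_le_comap p k)

lemma conjMod_mk {k : ℕ} (x : O p) :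
    conjMod p k (Ideal.Quotient.mk _ x) = Ideal.Quotient.mk _ (conj p x) :=
  Ideal.quotientMap_mk

variable {p}

section

variable {χ : O p →+* ZMod p} (hχ : ∀ x, χ x = 0 ↔ z p - 1 ∣ x) {k : ℕ} (hk : k ≠ 0)

lemma residue_z (hχ : ∀ x, χ x = 0 ↔ z p - 1 ∣ x) : χ (z p) = 1 := by
  have := (hχ (z p - 1)).2 dvd_rfl
  rwa [map_sub, map_one, sub_eq_zero] at this

/-- Both z and its inverse have residue 1. Consequently the identity on `ZMod (p ^ s)` and
conjugation together preserve the fibre product. -/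
lemma residue_conj (hχ : ∀ x, χ x = 0 ↔ z p - 1 ∣ x) (x : O p) : χ (conj p x) = χ x := by
  let U : AddSubgroup (O p) := AddMonoidHom.eqLocus
    ((χ.comp (conj p : O p →+* O p) : O p →+* ZMod p) : O p →+ ZMod p) (χ : O p →+ ZMod p)
  have hU : U = ⊤ := span p U (by change χ (conj p 1) = χ 1; simp) fun u hu => by
    change χ (conj p (z p * u)) = χ (z p * u)
    change χ (conj p u) = χ u at hu
    rw [map_mul, map_mul, map_mul, conj_z, zi, map_pow, residue_z hχ, hu, one_pow]
  have : x ∈ U := hU ▸ AddSubgroup.mem_top x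
  exact this

/-- The residue map modulo a power of `z - 1`. -/
noncomputable def residueMod : O p ⧸ I p k →+* ZMod p :=
  Ideal.Quotient.lift (I p k) χ fun x hx =>
    (hχ x).2 ((dvd_pow_self _ hk).trans ((mem_I p).1 hx))

lemma residueMod_mk (x : O p) : residueMod hχ hk (Ideal.Quotient.mk _ x) = χ x := rfl

lemma residueMod_conjMod (x : O p ⧸ I p k) :
    residueMod hχ hk (conjMod p k x) = residueMod hχ hk x := by
  obtain ⟨x, rfl⟩ := Ideal.Quotient.mk_surjective x
  rw [conjMod_mk, residueMod_mk, residueMod_mk, residue_conj hχ]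

/-! ### The fibre product as a twisted ring -/

variable {s : ℕ} (hs : s ≠ 0)

/-- The fibre product of `ZMod (p ^ s)` and `O p ⧸ I p k` over the residue field. -/
noncomputable def fibre : Subring (ZMod (p ^ s) × (O p ⧸ I p k)) :=
  RingHom.eqLocus
    ((ZMod.castHom (dvd_pow_self p hs) (ZMod p)).comp (RingHom.fst _ _))
    ((residueMod hχ hk).comp (RingHom.snd _ _))

lemma mem_fibre {x : ZMod (p ^ s) × (O p ⧸ I p k)} : x ∈ fibre hχ hk hs ↔
    ZMod.castHom (dvd_pow_self p hs) (ZMod p) x.1 = residueMod hχ hk x.2 := Iff.rfl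

lemma finite_quotient (hp2 : p ≠ 2) : Finite (O p ⧸ I p k) :=
  Nat.finite_of_card_ne_zero (by
    rw [I, card_quotient p hp2]; exact pow_ne_zero _ hp.out.ne_zero)

lemma finite_fibre (hp2 : p ≠ 2) : Finite (fibre hχ hk hs) := by
  have := finite_quotient (p := p) (k := k) hp2
  have : NeZero (p ^ s) := ⟨pow_ne_zero _ hp.out.ne_zero⟩
  infer_instance

/-- The fibre product is the kernel of the difference of the two reductions, a surjection onto `ZMod
p`. -/
lemma card_fibre (hp2 : p ≠ 2) : p * Nat.card (fibre hχ hk hs) = p ^ (s + k) := by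
  let f : ZMod (p ^ s) × (O p ⧸ I p k) →+ ZMod p :=
    (((ZMod.castHom (dvd_pow_self p hs) (ZMod p)).comp (RingHom.fst _ _) :
      ZMod (p ^ s) × (O p ⧸ I p k) →+* ZMod p) : _ →+ ZMod p) -
    (((residueMod hχ hk).comp (RingHom.snd _ _) :
      ZMod (p ^ s) × (O p ⧸ I p k) →+* ZMod p) : _ →+ ZMod p)
  have hf : ∀ x, f x = ZMod.castHom (dvd_pow_self p hs) (ZMod p) x.1 - residueMod hχ hk x.2 :=
    fun x => rfl
  have hsurj : Function.Surjective f := fun a => by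
    obtain ⟨n, rfl⟩ := ZMod.natCast_zmod_surjective a
    exact ⟨((n : ZMod (p ^ s)), 0), by rw [hf, map_zero, sub_zero, map_natCast]⟩
  have hker : Nat.card f.ker = Nat.card (fibre hχ hk hs) :=
    Nat.card_congr (Equiv.subtypeEquivRight fun x => by
      rw [AddMonoidHom.mem_ker, hf, sub_eq_zero, mem_fibre])
  have h1 := AddSubgroup.card_eq_card_quotient_mul_card_addSubgroup f.ker
  rw [Nat.card_congr (QuotientAddGroup.quotientKerEquivOfSurjective f hsurj).toEquiv, hker,
    Nat.card_prod, Nat.card_zmod, Nat.card_zmod] at h1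
  have h2 : Nat.card (O p ⧸ I p k) = p ^ k := card_quotient p hp2 k
  rw [h2] at h1
  rw [← h1, pow_add]

/-- The root of unity in the fibre product. -/
noncomputable def tUnit : (fibre hχ hk hs)ˣ where
  val := ⟨(1, Ideal.Quotient.mk _ (z p)), by
    rw [mem_fibre, residueMod_mk, map_one, residue_z hχ]⟩
  inv := ⟨(1, Ideal.Quotient.mk _ (zi p)), by
    rw [mem_fibre, residueMod_mk, map_one, zi, map_pow, residue_z hχ, one_pow]⟩
  val_inv := by
    refine Subtype.ext (Prod.ext (one_mul _) ?_)
    change Ideal.Quotient.mk _ (z p) * Ideal.Quotient.mk _ (zi p) = 1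
    rw [← map_mul, z_mul_zi, map_one]
  inv_val := by
    refine Subtype.ext (Prod.ext (one_mul _) ?_)
    change Ideal.Quotient.mk _ (zi p) * Ideal.Quotient.mk _ (z p) = 1
    rw [← map_mul, mul_comm, z_mul_zi, map_one]

lemma coe_tUnit_pow (n : ℕ) : (((tUnit hχ hk hs : (fibre hχ hk hs)ˣ) : fibre hχ hk hs) ^ n).1 =
    (1, Ideal.Quotient.mk _ (z p ^ n)) := by
  rw [SubmonoidClass.coe_pow]
  exact Prod.ext (one_pow _) (map_pow _ _ _).symm

/-- Conjugation on the fibre product. -/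
noncomputable def fibreBar : fibre hχ hk hs →+* fibre hχ hk hs :=
  ((RingHom.prodMap (RingHom.id _) (conjMod p k)).comp (fibre hχ hk hs).subtype).codRestrict
    (fibre hχ hk hs) fun x => by
      rw [mem_fibre]
      change ZMod.castHom (dvd_pow_self p hs) (ZMod p) x.1.1 =
        residueMod hχ hk (conjMod p k x.1.2)
      rw [residueMod_conjMod]
      exact x.2

lemma coe_norm : (∑ i ∈ Finset.range p,
    ((tUnit hχ hk hs : (fibre hχ hk hs)ˣ) : fibre hχ hk hs) ^ i).1 = ((p : ZMod (p ^ s)), 0) := by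
  rw [AddSubmonoidClass.coe_finsetSum]
  simp only [coe_tUnit_pow]
  refine Prod.ext ?_ ?_
  · rw [Prod.fst_sum]
    simp
  · rw [Prod.snd_sum, ← map_sum, geom_sum, map_zero]

/-- Second coordinates of U fill the quotient of O = ℤ[z]. The kernel of the second projection
consists of the multiples of (p, 0), which is the sum of the powers of t and so lies in U. -/
lemma fibre_span (U : AddSubgroup (fibre hχ hk hs)) (h1 : 1 ∈ U)
    (ht : ∀ u ∈ U, (tUnit hχ hk hs : fibre hχ hk hs) * u ∈ U) : U = ⊤ := by
  have hpow : ∀ n, (tUnit hχ hk hs : fibre hχ hk hs) ^ n ∈ U := by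
    intro n
    induction n with
    | zero => simpa
    | succ n ih => rw [pow_succ']; exact ht _ ih
  have hN := U.sum_mem (t := Finset.range p) fun i _ => hpow i
  have hsnd : ∀ β : O p, ∃ u ∈ U, u.1.2 = Ideal.Quotient.mk (I p k) β := by
    let V : AddSubgroup (O p) :=
      { carrier := {β | ∃ u ∈ U, u.1.2 = Ideal.Quotient.mk (I p k) β}
        zero_mem' := ⟨0, U.zero_mem, (map_zero _).symm⟩
        add_mem' := by
          rintro a b ⟨u, hu, ha⟩ ⟨v, hv, hb⟩
          refine ⟨u + v, U.add_mem hu hv, ?_⟩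
          rw [map_add, ← ha, ← hb]; rfl
        neg_mem' := by
          rintro a ⟨u, hu, ha⟩
          refine ⟨-u, U.neg_mem hu, ?_⟩
          rw [map_neg, ← ha]; rfl }
    have hV : V = ⊤ := span p V ⟨1, h1, (map_one _).symm⟩ (by
      rintro a ⟨u, hu, ha⟩
      refine ⟨_, ht u hu, ?_⟩
      rw [map_mul, ← ha]; rfl)
    intro β
    have : β ∈ V := hV ▸ AddSubgroup.mem_top β
    exact this
  rw [eq_top_iff]
  intro x _
  obtain ⟨β, hβ⟩ := Ideal.Quotient.mk_surjective x.1.2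
  obtain ⟨u, hu, huβ⟩ := hsnd β
  obtain ⟨a, ha⟩ := ZMod.natCast_zmod_surjective (x - u).1.1
  have h2 : (x - u).1.2 = 0 := by
    change x.1.2 - u.1.2 = 0
    rw [huβ, hβ, sub_self]
  have hdvd : p ∣ a := by
    have := (mem_fibre hχ hk hs).1 (x - u).2
    rw [h2, ← ha, map_zero, map_natCast] at this
    exact (ZMod.natCast_eq_zero_iff _ _).1 this
  obtain ⟨b, rfl⟩ := hdvd
  have hxu : x - u = b • ∑ i ∈ Finset.range p, (tUnit hχ hk hs : fibre hχ hk hs) ^ i := by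
    refine Subtype.ext ?_
    rw [AddSubmonoidClass.coe_nsmul, coe_norm]
    refine Prod.ext ?_ ?_
    · rw [← ha, Prod.smul_fst, nsmul_eq_mul, Nat.cast_mul, mul_comm]
    · rw [h2, Prod.smul_snd, smul_zero]
  have := U.add_mem (U.nsmul_mem hN b) hu
  rwa [← hxu, sub_add_cancel] at this

/-- As p is associated to (z - 1)^(p-1), p^a vanishes in the second factor exactly when k ≤ (p-1)a,
and the least such a is n + 1. The bound s ≤ n + 1 keeps the first factor from raising the order. -/
lemma addOrderOf_fibre_one {n r : ℕ} (hkn : k = (p - 1) * n + r) (hr : 1 ≤ r) (hr' : r ≤ p - 1)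
    (hsn : s ≤ n + 1) : addOrderOf (1 : fibre hχ hk hs) = p ^ (n + 1) := by
  have hcast : ∀ m : ℕ, (m • (1 : fibre hχ hk hs)).1 =
      ((m : ZMod (p ^ s)), Ideal.Quotient.mk (I p k) (m : O p)) := fun m => by
    rw [nsmul_one, map_natCast]
    exact Prod.ext (by simp) (by simp)
  refine addOrderOf_eq_prime_pow ?_ ?_
  · intro h
    have h1 := congrArg (fun x : fibre hχ hk hs => x.1.2) h
    simp only [hcast] at h1
    have h2 := (mk_eq_zero_iff p).1 (h1.trans rfl)
    rw [Nat.cast_pow, lam_pow_dvd_p_pow_iff] at h2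
    omega
  · refine Subtype.ext ?_
    rw [hcast]
    refine Prod.ext ?_ ?_
    · exact (ZMod.natCast_eq_zero_iff _ _).2 (pow_dvd_pow p hsn)
    · refine (mk_eq_zero_iff p).2 ?_
      rw [Nat.cast_pow, lam_pow_dvd_p_pow_iff, mul_add, mul_one]
      omega

/-- The fibre product is a twisted ring. -/
noncomputable def twistedRing {n r : ℕ} (hkn : k = (p - 1) * n + r) (hr : 1 ≤ r) (hr' : r ≤ p - 1)
    (hsn : s ≤ n + 1) (hk2 : Even k) (hs2 : s ≤ 2) :
    TwistedRing p (n + 1) (fibre hχ hk hs) where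
  t := tUnit hχ hk hs
  bar := fibreBar hχ hk hs
  w := ⟨(0, Ideal.Quotient.mk _ ((z p - 1) ^ (k - 1))), by
    rw [mem_fibre, residueMod_mk, map_zero, eq_comm, hχ]
    -- The exponent k - 1 is nonzero because k is even and positive, so w has residue 0.
    exact dvd_pow_self _ fun h => by
      have : k = 1 := by omega
      simp [this] at hk2⟩
  bar_bar x := by
    refine Subtype.ext (Prod.ext rfl ?_)
    obtain ⟨y, hy⟩ := Ideal.Quotient.mk_surjective x.1.2
    change conjMod p k (conjMod p k x.1.2) = x.1.2
    rw [← hy, conjMod_mk, conjMod_mk, conj_conj]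
  bar_t := by
    refine Subtype.ext (Prod.ext rfl ?_)
    change conjMod p k (Ideal.Quotient.mk _ (z p)) = Ideal.Quotient.mk _ (zi p)
    rw [conjMod_mk, conj_z]
  t_pow := by
    refine Units.ext (Subtype.ext ?_)
    rw [Units.val_pow_eq_pow_val, coe_tUnit_pow, z_pow, map_one]
    rfl
  t_w := by
    refine Subtype.ext (Prod.ext (mul_zero _) ?_)
    change Ideal.Quotient.mk _ (z p) * Ideal.Quotient.mk _ ((z p - 1) ^ (k - 1)) =
      Ideal.Quotient.mk _ ((z p - 1) ^ (k - 1))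
    rw [← map_mul, ← sub_eq_zero, ← map_sub, mk_eq_zero_iff]
    have e : (z p - 1) ^ k = (z p - 1) ^ (k - 1) * (z p - 1) := by
      rw [← pow_succ, Nat.sub_add_cancel (by omega)]
    exact ⟨1, by rw [e]; ring⟩
  bar_w := by
    refine Subtype.ext (Prod.ext neg_zero.symm ?_)
    change conjMod p k (Ideal.Quotient.mk _ ((z p - 1) ^ (k - 1))) =
      -Ideal.Quotient.mk _ ((z p - 1) ^ (k - 1))
    rw [conjMod_mk, eq_neg_iff_add_eq_zero, ← map_add, mk_eq_zero_iff]
    exact lam_pow_dvd_conj_add p hk2 hk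
  w_ne h := by
    have h1 := congrArg (fun x : fibre hχ hk hs => x.1.2) h
    have h2 := (mk_eq_zero_iff p).1 (h1.trans rfl)
    rw [lam_pow_dvd_iff] at h2
    omega
  p_w := by
    refine Subtype.ext (Prod.ext (mul_zero _) ?_)
    change ((p : fibre hχ hk hs) : ZMod (p ^ s) × (O p ⧸ I p k)).2 *
      Ideal.Quotient.mk _ ((z p - 1) ^ (k - 1)) = 0
    have e : (z p - 1) ^ k = (z p - 1) * (z p - 1) ^ (k - 1) := by
      rw [← pow_succ', Nat.sub_add_cancel (by omega)]
    have e2 : ((p : fibre hχ hk hs) : ZMod (p ^ s) × (O p ⧸ I p k)).2 =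
      Ideal.Quotient.mk _ (p : O p) := by simp
    rw [e2, ← map_mul, mk_eq_zero_iff, e]
    exact mul_dvd_mul_right (lam_dvd_p p) _
  -- The norm is (p, 0), so s ≤ 2 is exactly what makes p times it vanish.
  p_norm := by
    rw [← nsmul_eq_mul]
    refine Subtype.ext ?_
    rw [AddSubmonoidClass.coe_nsmul, coe_norm]
    refine Prod.ext ?_ (smul_zero _)
    rw [Prod.smul_fst, nsmul_eq_mul, ← Nat.cast_mul, ← pow_two]
    exact (ZMod.natCast_eq_zero_iff _ _).2 (pow_dvd_pow p hs2)
  span := fibre_span hχ hk hs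
  addOrderOf_one := addOrderOf_fibre_one hχ hk hs hkn hr hr' hsn

end

end CyclotomicInt

/-! ### Choice of parameters -/

theorem theorem3 (p m : ℕ) (hp : p.Prime) (hp_odd : Odd p) (hm : 5 ≤ m)
    (hpar : Odd m ∨ (Even m ∧ p + 3 ≤ m)) :
    ∃ (P : AbstractPolytope.{0} 3) (e r : ℕ),
      P.IsChiral ∧ ¬ P.IsTight ∧ Nat.card P.Aut = 2 * p ^ m ∧
      P.HasSchlafliType ![p ^ 2, 2 * p ^ e] ∧
      1 ≤ e ∧ Even r ∧ 1 ≤ r ∧ r ≤ p - 1 ∧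
      (Odd m → m = (p - 1) * (e - 1) + r + 1) ∧
      (Even m → m = (p - 1) * (e - 1) + r + 2) := by
  have := Fact.mk hp
  have hp2 : p ≠ 2 := by rintro rfl; exact absurd hp_odd (by decide)
  have hp3 : 3 ≤ p := by have := hp.two_le; omega
  -- The group has order 2p^(k+s), and s is chosen by parity to make k even. For s = 2 the bound m ≥
  -- p + 3 gives k > p - 1, hence n ≥ 1 and s ≤ n + 1 below.
  obtain ⟨k, s, hs, hs2, hmk, hk, hk4, hm1, hm2, hsk⟩ : ∃ k s : ℕ, s ≠ 0 ∧ s ≤ 2 ∧ m = k + s ∧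
      Even k ∧ 4 ≤ k ∧ (Odd m → s = 1) ∧ (Even m → s = 2) ∧ (s = 1 ∨ p + 1 ≤ k) := by
    rcases hpar with h | ⟨h, h'⟩
    · refine ⟨m - 1, 1, one_ne_zero, by omega, by omega, Nat.Odd.sub_odd h odd_one, by omega,
        fun _ => rfl, fun h'' => ?_, Or.inl rfl⟩
      exact (Nat.not_even_iff_odd.2 h h'').elim
    · refine ⟨m - 2, 2, two_ne_zero, le_rfl, by omega, (Nat.even_sub (by omega)).2 (by simp [h]),
        by omega, fun h'' => ?_, fun _ => rfl, Or.inr (by omega)⟩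
      exact (Nat.not_even_iff_odd.2 h'' h).elim
  obtain ⟨n, r, hkn, hr, hr'⟩ : ∃ n r : ℕ, k = (p - 1) * n + r ∧ 1 ≤ r ∧ r ≤ p - 1 := by
    -- Division shifted by one, so that the remainder r lies in 1, …, p - 1.
    refine ⟨(k - 1) / (p - 1), (k - 1) % (p - 1) + 1, ?_, by omega, ?_⟩
    · have := Nat.div_add_mod (k - 1) (p - 1)
      omega
    · exact Nat.mod_lt _ (by omega)
  have hpn : n = 0 ∨ 2 * n ≤ (p - 1) * n := Or.inr (Nat.mul_le_mul_right n (by omega))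
  have hsn : s ≤ n + 1 := by
    rcases Nat.eq_zero_or_pos n with rfl | hn
    · rcases hsk with h | h
      · omega
      · rw [mul_zero] at hkn; omega
    · omega
  have hr2 : Even r := by
    have he : Even ((p - 1) * n) := (Nat.Odd.sub_odd hp_odd odd_one).mul_right n
    rw [hkn] at hk
    exact (Nat.even_add.1 hk).1 he
  obtain ⟨χ, hχ⟩ := CyclotomicInt.exists_residue p hp2
  have hk0 : k ≠ 0 := by omega
  have := CyclotomicInt.finite_fibre hχ hk0 hs hp2
  have hcard : 2 * p * Nat.card (CyclotomicInt.fibre hχ hk0 hs) = 2 * p ^ m := by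
    rw [mul_assoc, CyclotomicInt.card_fibre hχ hk0 hs hp2, hmk, add_comm]
  obtain ⟨P, h1, h2, h3, h4⟩ :=
    (CyclotomicInt.twistedRing hχ hk0 hs hkn hr hr' hsn hk hs2).exists_chiral_polyhedron hp2
  rw [hcard] at h2 h3
  refine ⟨P, n + 1, r, h1, ?_, h3, h4, by omega, hr2, hr, hr', fun h => ?_, fun h => ?_⟩
  · rw [h2]
    intro h
    -- Tightness means m = n + 3. But m = k + s with k ≥ 4 forces n ≥ 2, and then k ≥ 2n + 1 makes m
    -- too large.
    have h5 : p ^ m = p ^ (n + 1 + 2) := by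
      have : 2 * p ^ m = 2 * p ^ (n + 1 + 2) := by rw [h]; ring
      omega
    have h6 := Nat.pow_right_injective hp.two_le h5
    rcases Nat.eq_zero_or_pos n with rfl | hn <;> omega
  · rw [Nat.add_sub_cancel, ← hkn, hmk, hm1 h]
  · rw [Nat.add_sub_cancel, ← hkn, hmk, hm2 h]
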